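/- Let $\mathfrak g$ be a finite-dimensional simple Lie algebra over $\mathbb C$ with a Cartan subalgebra $\mathfrak h$, positive roots $R^+$ (for a fixed choice of simple roots $\alpha_i$, $i\in I$), and root vectors $x_\alpha^{\pm}\in\mathfrak g_{\pm\alpha}$ with $[x_\alpha^+,x_\alpha^-]=h_\alpha$, the coroot of $\alpha$ ($\alpha\in R^+$); write $x_i^-=x_{\alpha_i}^-$, $h_i=h_{\alpha_i}$, and $\mathfrak n^+=\bigoplus_{\alpha\in R^+}\mathfrak g_\alpha$. Let $\mathfrak g[t]=\mathfrak g\otimes\mathbb C[t]$, and for $N\in\mathbb Z_{>0}$ let $\mathfrak g[t]_N=\mathfrak g\otimes\mathbb C[t]/(t^N)$; put $\mathfrak g[t]_\infty=\mathfrak g[t]$. Let $\lambda\in\mathfrak h^*$ be dominant integral, i.e. $\lambda(h_i)\in\mathbb Z_{\ge0}$ for all $i\in I$. For $N\in\mathbb Z_{>0}\cup\{\infty\}$, the truncated local Weyl module $W_N(\lambda)$ is the $\mathfrak g[t]_N$-module generated by a vector $v$ with defining relations $$(x\otimes a)v=0\ \ (x\in\mathfrak n^+,\ a\in\mathbb C[t]/(t^N)),\qquad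 (h\otimes t^r)v=\delta_{r,0}\,\lambda(h)v\ \ (h\in\mathfrak h,\ r\ge0),\qquad (x_i^-)^{\lambda(h_i)+1}v=0\ \ (i\in I),$$ where $\mathbb C[t]/(t^\infty)$ means $\mathbb C[t]$. It is regarded as a $\mathfrak g[t]$-module through $\mathfrak g[t]\to\mathfrak g[t]_N$. Put $W(\lambda)=W_\infty(\lambda)$, with generator $w$. For a family $\xi=(\xi(\alpha))_{\alpha\in R^+}$ in which $\xi(\alpha)=(\xi(\alpha)_1\ge\xi(\alpha)_2\ge\cdots)$ is a partition of $\lambda(h_\alpha)$, the Chari–Venkatesh module $CV(\xi)$ is the quotient of $W(\lambda)$ by the $\mathfrak g[t]$-submodule generated by the vectors $$(x_\alpha^+\otimes t)^s(x_\alpha^-)^{s+r}w,\qquad \alpha\in R^+,\ s,r\in\mathbb Z_{>0},\quad s+r>rk+\sum_{j>k}\xi(\alpha)_j\ \text{ for some } k\in\mathbb Z_{>0}.$$ Both modules are $\mathbb Z$-graded $\mathfrak g[t]$-modules, with generator in degree $0$ and $x\otimes t^r$ raising degrees by $r$. **Theorem.** Let $N\in\mathbb Z_{>0}\cup\{\infty\}$.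 For $\alpha\in R^+$ let $q_\alpha,p_\alpha$ be the integers with $\lambda(h_\alpha)=Nq_\alpha+p_\alpha$ and $0\le p_\alpha<N$ (with $q_\alpha=0$ and $p_\alpha=\lambda(h_\alpha)$ if $N=\infty$), and let $\xi_N^\lambda(\alpha)$ be the partition $\big((q_\alpha+1)^{(p_\alpha)},q_\alpha^{(N-p_\alpha)}\big)$ of $\lambda(h_\alpha)$, where $k^{(a)}$ means that the part $k$ is repeated $a$ times and zero parts are ignored. Then $CV(\xi_N^\lambda)$ and $W_N(\lambda)$ are isomorphic as graded $\mathfrak g[t]$-modules. -/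

import Mathlib

open scoped TensorProduct Polynomial
open LieAlgebra LieAlgebra.IsKilling

noncomputable section

/-! ### Positive coroots are nonnegative combinations of simple coroots -/

theorem RootPairing.Base.IsPos.coroot_mem_closure {ι R M N : Type*} [Finite ι] [Field R]
    [CharZero R] [AddCommGroup M] [Module R M] [AddCommGroup N] [Module R N]
    {P : RootPairing ι R M N} [P.IsCrystallographic] [P.IsReduced] {b : P.Base} {i : ι}
    (hi : b.IsPos i) : P.coroot i ∈ AddSubmonoid.closure (P.coroot '' b.support) := by
  let := P.indexNeg
  have key : b.IsPos i → b.flip.IsPos i := by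
    refine hi.induction_on_reflect (p := fun i => b.IsPos i → b.flip.IsPos i) ?_ ?_
    · intro i hi _
      exact RootPairing.Base.isPos_of_mem_support (b := b.flip) hi
    · intro i j ih hj h
      rcases eq_or_ne i j with rfl | hij
      · exact absurd (RootPairing.Base.isPos_of_mem_support hj)
          ((RootPairing.Base.IsPos.neg_iff_not b i).1 h)
      · by_cases h1 : b.IsPos i
        · exact (ih h1).reflectionPerm (b := b.flip) hj hij
        · have h2 : b.IsPos (-i) := (RootPairing.Base.IsPos.neg_iff_not b i).2 h1
          have h3 : P.reflectionPerm j (-i) = -(P.reflectionPerm j i) := by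
            apply P.root.injective
            simp only [RootPairing.root_reflectionPerm, RootPairing.indexNeg_neg,
              RootPairing.reflection_apply_self, map_neg]
            rw [← RootPairing.root_reflectionPerm, RootPairing.reflection_apply_self]
          rcases eq_or_ne (-i) j with e | e
          · have : P.reflectionPerm j i = j := by
              rw [← neg_neg (P.reflectionPerm j i), ← h3, e, ← RootPairing.indexNeg_neg, neg_neg]
            rw [this]
            exact RootPairing.Base.isPos_of_mem_support (b := b.flip) hj
          · have h4 := h2.reflectionPerm hj e
            rw [h3] at h4
            exact absurd h ((RootPairing.Base.IsPos.neg_iff_not b _).1 h4)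
  obtain ⟨f, -, h | h⟩ := b.flip.exists_root_eq_sum_nat_or_neg i
  · rw [RootPairing.flip_root] at h
    rw [h]
    refine AddSubmonoid.sum_mem _ fun j hj => AddSubmonoid.nsmul_mem _ ?_ _
    exact AddSubmonoid.subset_closure ⟨j, hj, rfl⟩
  · exfalso
    have h' : P.flip.root i = ∑ j ∈ b.flip.support, (fun j => -(f j : ℤ)) j • P.flip.root j := by
      rw [h]; simp
    have h3 := RootPairing.Base.height_eq_sum h'
    have h4 : 0 < b.flip.height i := key hi
    rw [h3, Finset.sum_neg_distrib] at h4
    have : 0 ≤ ∑ j ∈ b.flip.support, (f j : ℤ) := Finset.sum_nonneg fun _ _ => by positivity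
    omega

/-! ### Current algebras and their modules -/

/-- The current algebra `𝔤[t] = ℂ[t] ⊗ 𝔤`, with bracket `[a ⊗ x, b ⊗ y] = ab ⊗ [x, y]`. -/
abbrev CurrentAlgebra (𝔤 : Type*) [LieRing 𝔤] [LieAlgebra ℂ 𝔤] : Type _ := ℂ[X] ⊗[ℂ] 𝔤

/-- The ideal `(t ^ N)` of `ℂ[t]`, which is zero for `N = ∞`. -/
def truncIdeal : ℕ∞ → Ideal ℂ[X]
  | ⊤ => ⊥
  | (n : ℕ) => Ideal.span {Polynomial.X ^ n}

/-- `ℂ[t]/(t ^ N)`. The truncated current algebra `𝔤[t]_N` is `TruncatedPoly N ⊗[ℂ] 𝔤`. -/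
abbrev TruncatedPoly (N : ℕ∞) : Type := ℂ[X] ⧸ truncIdeal N

section Grading

variable {𝔤 : Type*} [LieRing 𝔤] [LieAlgebra ℂ 𝔤]
  {M : Type*} [AddCommGroup M] [Module ℂ M] [LieRingModule (CurrentAlgebra 𝔤) M]

/-- For a vector `v` of a `𝔤[t]`-module, the span of all
`(x₁ ⊗ t ^ r₁) ⋯ (x_l ⊗ t ^ r_l) v` with `r₁ + ⋯ + r_l = k`, that is, `U(𝔤[t])[k] v`. -/
def cyclicPiece (v : M) (k : ℤ) : Submodule ℂ M :=
  Submodule.span ℂ {m | ∃ l : List (ℕ × 𝔤), ((l.map Prod.fst).sum : ℤ) = k ∧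
    m = l.foldr
      (fun p m' => ⁅((Polynomial.X ^ p.1 : ℂ[X]) ⊗ₜ[ℂ] p.2 : CurrentAlgebra 𝔤), m'⁆) v}

variable (𝔤) in
/-- A family of subspaces makes `M` a `ℤ`-graded `𝔤[t]`-module: `M` is their direct sum and
`x ⊗ t ^ r` raises degrees by `r`. -/
def IsModuleGrading (G : ℤ → Submodule ℂ M) : Prop :=
  DirectSum.IsInternal G ∧
    ∀ (r : ℕ) (x : 𝔤) (k : ℤ), ∀ m ∈ G k,
      ⁅((Polynomial.X ^ r : ℂ[X]) ⊗ₜ[ℂ] x : CurrentAlgebra 𝔤), m⁆ ∈ G (k + r)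

end Grading

/-! ### Root vectors and dominant integral weights -/

variable {𝔤 : Type*} [LieRing 𝔤] [LieAlgebra ℂ 𝔤] [FiniteDimensional ℂ 𝔤] [IsKilling ℂ 𝔤]
  {H : LieSubalgebra ℂ 𝔤} [H.IsCartanSubalgebra]

/-- The set `R⁺` of positive roots with respect to a base. -/
abbrev PosRoot (b : (rootSystem H).Base) : Type _ := {α : H.root // b.IsPos α}

/-- A simple root, as a positive root. -/
def simpleRoot {b : (rootSystem H).Base} (i : b.support) : PosRoot b :=
  ⟨i, RootPairing.Base.isPos_of_mem_support i.2⟩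

/-- The coroot `h_α`. -/
def PosRoot.h {b : (rootSystem H).Base} (α : PosRoot b) : H := (rootSystem H).coroot α.1

/-- Root vectors `x_α^±` with `[x_α^+, x_α^-] = h_α` for all positive roots `α`. The root vectors
of a Chevalley basis are an example; no integrality of the structure constants is required. -/
structure RootVectors (b : (rootSystem H).Base) where
  pos : PosRoot b → 𝔤
  neg : PosRoot b → 𝔤
  pos_mem : ∀ α : PosRoot b, pos α ∈ rootSpace H (α.1.1 : H → ℂ)
  neg_mem : ∀ α : PosRoot b, neg α ∈ rootSpace H (-(α.1.1 : H → ℂ))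
  lie_pos_neg : ∀ α : PosRoot b, ⁅pos α, neg α⁆ = (α.h : 𝔤)

/-- `λ ∈ P⁺`: the values of `λ` on the simple coroots are nonnegative integers. -/
def IsDominantIntegral (b : (rootSystem H).Base) (lam : Module.Dual ℂ H) : Prop :=
  ∀ i : b.support, ∃ n : ℕ, lam (simpleRoot i).h = n

/-- The natural number `λ(h_α)`, for `λ ∈ P⁺` and `α ∈ R⁺` (see `cast_natPairing`). -/
def natPairing {b : (rootSystem H).Base} (lam : Module.Dual ℂ H) (α : PosRoot b) : ℕ :=
  ⌊(lam α.h).re⌋₊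

theorem cast_natPairing {b : (rootSystem H).Base} {lam : Module.Dual ℂ H}
    (hlam : IsDominantIntegral b lam) (α : PosRoot b) :
    (natPairing lam α : ℂ) = lam α.h := by
  have h : ∃ n : ℕ, lam α.h = n := by
    have hmem := α.2.coroot_mem_closure
    refine AddSubmonoid.closure_induction (motive := fun y _ => ∃ n : ℕ, lam y = n) ?_ ?_ ?_ hmem
    · rintro _ ⟨i, hi, rfl⟩
      exact hlam ⟨i, hi⟩
    · exact ⟨0, by simp⟩
    · rintro y z - - ⟨m, hm⟩ ⟨n, hn⟩
      exact ⟨m + n, by simp [hm, hn]⟩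
  obtain ⟨n, hn⟩ := h
  simp [natPairing, hn]

/-! ### Local Weyl modules -/

section Weyl

/-- The elements `u` of `U(𝔤 ⊗ A)` for which `u v = 0` is a defining relation of the local Weyl
module over `𝔤 ⊗ A`, where `A` is a `ℂ[t]`-algebra. -/
inductive IsWeylRelation {b : (rootSystem H).Base} (x : RootVectors b) (lam : Module.Dual ℂ H)
    (A : Type) [CommRing A] [Algebra ℂ A] [Algebra ℂ[X] A] :
    UniversalEnvelopingAlgebra ℂ (A ⊗[ℂ] 𝔤) → Prop
  /-- `𝔫⁺ ⊗ A` annihilates `v` -/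
  | raising (a : A) (α : PosRoot b) :
      IsWeylRelation x lam A (UniversalEnvelopingAlgebra.ι ℂ (a ⊗ₜ[ℂ] x.pos α))
  /-- `(h ⊗ t ^ r) v = δ_{r,0} λ(h) v` -/
  | cartan (h : H) (r : ℕ) :
      IsWeylRelation x lam A
        (UniversalEnvelopingAlgebra.ι ℂ
            ((algebraMap ℂ[X] A Polynomial.X ^ r) ⊗ₜ[ℂ] (h : 𝔤)) -
          algebraMap ℂ _ (if r = 0 then lam h else 0))
  /-- `(x_i^-) ^ (λ(h_i) + 1) v = 0` -/
  | lowering (i : b.support) :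
      IsWeylRelation x lam A
        (UniversalEnvelopingAlgebra.ι ℂ ((1 : A) ⊗ₜ[ℂ] x.neg (simpleRoot i)) ^
          (natPairing lam (simpleRoot i) + 1))

variable {b : (rootSystem H).Base} (x : RootVectors b) (lam : Module.Dual ℂ H)
  (A : Type) [CommRing A] [Algebra ℂ A] [Algebra ℂ[X] A] [IsScalarTower ℂ ℂ[X] A]

/-- The `𝔤 ⊗ A`-module with a generator `v` and the local Weyl relations as defining relations. -/
def WeylModule : Type _ :=
  UniversalEnvelopingAlgebra ℂ (A ⊗[ℂ] 𝔤) ⧸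
    (Submodule.span (UniversalEnvelopingAlgebra ℂ (A ⊗[ℂ] 𝔤)) {u | IsWeylRelation x lam A u})

namespace WeylModule

instance : AddCommGroup (WeylModule x lam A) :=
  inferInstanceAs (AddCommGroup (_ ⧸ Submodule.span _ _))

instance : Module (UniversalEnvelopingAlgebra ℂ (A ⊗[ℂ] 𝔤)) (WeylModule x lam A) :=
  inferInstanceAs (Module _ (_ ⧸ Submodule.span _ _))

instance : Module ℂ (WeylModule x lam A) :=
  inferInstanceAs (Module ℂ (_ ⧸ Submodule.span _ _))

instance : IsScalarTower ℂ (UniversalEnvelopingAlgebra ℂ (A ⊗[ℂ] 𝔤)) (WeylModule x lam A) :=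
  inferInstanceAs (IsScalarTower ℂ _ (_ ⧸ Submodule.span _ _))

/-- The generator `v`. -/
def gen : WeylModule x lam A := Submodule.Quotient.mk 1

variable (𝔤) in
/-- The homomorphism `𝔤[t] → 𝔤 ⊗ A` induced by `ℂ[t] → A`. -/
def currentMap : CurrentAlgebra 𝔤 →ₗ⁅ℂ⁆ A ⊗[ℂ] 𝔤 :=
  ExtendScalars.map (IsScalarTower.toAlgHom ℂ ℂ[X] A) (LieHom.id : 𝔤 →ₗ⁅ℂ⁆ 𝔤)

/-- Modules for `𝔤 ⊗ A` are regarded as `𝔤[t]`-modules by pullback along `𝔤[t] → 𝔤 ⊗ A`. -/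
instance : LieRingModule (CurrentAlgebra 𝔤) (WeylModule x lam A) where
  bracket y m := UniversalEnvelopingAlgebra.ι ℂ (currentMap 𝔤 A y) • m
  add_lie y z m := by
    change UniversalEnvelopingAlgebra.ι ℂ (currentMap 𝔤 A (y + z)) • m = _
    rw [map_add, map_add, add_smul]
  lie_add y m n := smul_add _ m n
  leibniz_lie y z m := by
    change _ • _ • m =
      UniversalEnvelopingAlgebra.ι ℂ (currentMap 𝔤 A ⁅y, z⁆) • m + _ • _ • m
    let := LieRing.ofAssociativeRing (A := UniversalEnvelopingAlgebra ℂ (A ⊗[ℂ] 𝔤))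
    rw [LieHom.map_lie, LieHom.map_lie, LieRing.of_associative_ring_bracket]
    simp only [smul_smul, sub_smul]
    abel

theorem lie_def (y : CurrentAlgebra 𝔤) (m : WeylModule x lam A) :
    ⁅y, m⁆ = UniversalEnvelopingAlgebra.ι ℂ (currentMap 𝔤 A y) • m := rfl

instance : LieModule ℂ (CurrentAlgebra 𝔤) (WeylModule x lam A) where
  smul_lie c y m := by
    rw [lie_def, lie_def, map_smul, map_smul, smul_assoc]
  lie_smul c y m := by
    rw [lie_def, lie_def, ← algebraMap_smul (UniversalEnvelopingAlgebra ℂ (A ⊗[ℂ] 𝔤)) c m,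
      ← algebraMap_smul (UniversalEnvelopingAlgebra ℂ (A ⊗[ℂ] 𝔤)) c (_ • m), smul_smul, smul_smul,
      Algebra.commutes]

end WeylModule

/-- The truncated local Weyl module `W_N(λ)`, a module over `𝔤[t]_N`; for `N = ∞` it is `W(λ)`. -/
abbrev TruncatedWeylModule (N : ℕ∞) : Type _ := WeylModule x lam (TruncatedPoly N)

/-! ### Chari–Venkatesh modules -/

/-- A `λ`-compatible family of partitions `(ξ(α))_{α ∈ R⁺}`: each `ξ(α)` partitions `λ(h_α)`. -/
abbrev CompatibleFamily (b : (rootSystem H).Base) (lam : Module.Dual ℂ H) : Type _ :=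
  ∀ α : PosRoot b, (natPairing lam α).Partition

/-- `∑_{j > k} p_j` for a partition `p = (p₁ ≥ p₂ ≥ ⋯)`. -/
def partitionTail {n : ℕ} (p : n.Partition) (k : ℕ) : ℕ :=
  ((p.parts.sort (· ≥ ·)).drop k).sum

/-- The vectors `(x_α^+ ⊗ t) ^ s (x_α^-) ^ (s + r) w` of the graded local Weyl module `W(λ)`, over
`α ∈ R⁺` and `s, r > 0` with `s + r > r k + ∑_{j > k} ξ(α)_j` for some `k > 0`. -/
def cvRelations (xi : CompatibleFamily b lam) : Set (WeylModule x lam ℂ[X]) :=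
  {m | ∃ (α : PosRoot b) (s r : ℕ), 0 < s ∧ 0 < r ∧
    (∃ k : ℕ, 0 < k ∧ s + r > r * k + partitionTail (xi α) k) ∧
    m = (UniversalEnvelopingAlgebra.ι ℂ ((Polynomial.X : ℂ[X]) ⊗ₜ[ℂ] x.pos α) ^ s *
      UniversalEnvelopingAlgebra.ι ℂ ((1 : ℂ[X]) ⊗ₜ[ℂ] x.neg α) ^ (s + r)) •
        WeylModule.gen x lam ℂ[X]}

/-- The `𝔤[t]`-submodule of `W(λ)` generated by `cvRelations`. -/
def cvSubmodule (xi : CompatibleFamily b lam) :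
    LieSubmodule ℂ (CurrentAlgebra 𝔤) (WeylModule x lam ℂ[X]) :=
  LieSubmodule.lieSpan ℂ (CurrentAlgebra 𝔤) (cvRelations x lam xi)

/-- The module `CV(ξ)`, a quotient of `W(λ)`. -/
abbrev CVModule (xi : CompatibleFamily b lam) : Type _ :=
  WeylModule x lam ℂ[X] ⧸ cvSubmodule x lam xi

/-- The image in `CV(ξ)` of the generator of `W(λ)`. -/
def CVModule.gen (xi : CompatibleFamily b lam) : CVModule x lam xi :=
  LieSubmodule.Quotient.mk (WeylModule.gen x lam ℂ[X])

end Weyl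

/-! ### The family `ξ_N^λ` -/

/-- The multiset `((q + 1)^(p), q^(N - p))` where `n = N q + p` with `0 ≤ p < N`;
for `N = ∞` one has `q = 0` and `p = n`, and zero parts are dropped. -/
def truncParts (n : ℕ) : ℕ∞ → Multiset ℕ
  | ⊤ => Multiset.replicate n 1
  | (N : ℕ) => Multiset.replicate (n % N) (n / N + 1) + Multiset.replicate (N - n % N) (n / N)

theorem sum_truncParts (n : ℕ) {N : ℕ∞} (hN : N ≠ 0) : (truncParts n N).sum = n := by
  match N with
  | ⊤ =>
    change (Multiset.replicate n 1).sum = n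
    simp
  | (N : ℕ) =>
    have hN' : 0 < N := Nat.pos_of_ne_zero (by rintro rfl; exact hN rfl)
    have h1 : n % N + (N - n % N) = N := Nat.add_sub_cancel' (Nat.mod_lt n hN').le
    have h2 := Nat.div_add_mod n N
    simp only [truncParts, Multiset.sum_add, Multiset.sum_replicate, smul_eq_mul]
    calc n % N * (n / N + 1) + (N - n % N) * (n / N)
        = (n % N + (N - n % N)) * (n / N) + n % N := by ring
      _ = n := by rw [h1, h2]

/-- The `λ`-compatible family `ξ_N^λ` (zero parts are discarded). -/
def truncFamily (b : (rootSystem H).Base) (lam : Module.Dual ℂ H) (N : ℕ∞) (hN : N ≠ 0) :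
    CompatibleFamily b lam :=
  fun α => Nat.Partition.ofSums _ (truncParts (natPairing lam α) N) (sum_truncParts _ hN)

end

/-!
# `CV(ξ_N^λ)` and the truncated local Weyl module `W_N(λ)` are isomorphic

Both modules are quotients of `W(λ)`, and the two sets of additional relations imply each other.

* **From `CV(ξ_N^λ)` to `W_N(λ)`.** Commuting the raising operators to the right shows that
  `(x_α^+ ⊗ t) ^ s (x_α^-) ^ (s + r) w` is, up to sign, a nonempty sum of monomials
  `(x_α^- ⊗ t ^ p₁) ⋯ (x_α^- ⊗ t ^ p_r) w` with `p₁ + ⋯ + p_r = s`; this positivity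
  (`IsGarlandSum.exists_pow_pow_eq`) is all that is needed of Garland's identity. The parts of
  `ξ_N^λ(α)` are `q_α + 1` and `q_α`. If `r > q_α`, the inequality on `s + r` gives
  `s + r > λ(h_α)`, and the vector vanishes already in `W(λ)`. If `r ≤ q_α`, it gives
  `s > r (N - 1)`, so each monomial has some `p_i ≥ N` and vanishes in `W_N(λ)`
  (`TruncatedWeylModule.pow_pow_eq_zero`).
* **From `W_N(λ)` to `CV(ξ_N^λ)`.** For `r = 1` the sum above is a positive multiple of
  `(x_α^- ⊗ t ^ s) w`. As `ξ_N^λ(α)` has at most `N` parts, the relations of `CV(ξ_N^λ)` kill this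
  vector for `s ≥ N`, and then the whole ideal `𝔤 ⊗ (t ^ N)` acts by zero (`CVModule.tmul_lie`).

The first direction uses `(x_α^-) ^ (λ(h_α) + 1) w = 0` for all positive roots `α`, whereas only
simple roots appear in the definition. It holds in every highest weight module on which the simple
negative root vectors act locally nilpotently (`RootVectors.pow_toEnd_neg_eq_zero`): the weights are
stable under the simple reflections by `𝔰𝔩₂`-theory, hence under the reflection in `α`, which would
send a weight `λ - kα` with `k > λ(h_α)` to a weight that is not below `λ`.

The grading is detected by the substitution `t ↦ 2t`: it preserves the relations, so it acts on the
module, and it acts on the piece of degree `k` by `2 ^ k` (`isModuleGrading_cyclicPiece`).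
-/

noncomputable section

variable {𝔤 : Type*} [LieRing 𝔤] [LieAlgebra ℂ 𝔤] [FiniteDimensional ℂ 𝔤] [IsKilling ℂ 𝔤]
  {H : LieSubalgebra ℂ 𝔤} [H.IsCartanSubalgebra]

/-! ### Locally nilpotent actions and integrable representations of `𝔰𝔩₂` -/

section Integrability

open LieModule

/-- The action of an `ad`-nilpotent element on a module generated by `v` is locally nilpotent as
soon as it is nilpotent on `v`. -/
theorem LieModule.exists_pow_toEnd_eq_zero {L M : Type*} [LieRing L] [LieAlgebra ℂ L]
    [AddCommGroup M] [Module ℂ M] [LieRingModule L M] [LieModule ℂ L M] {y : L}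
    (hy : _root_.IsNilpotent (ad ℂ L y)) {v : M} (hgen : LieSubmodule.lieSpan ℂ L {v} = ⊤)
    {n : ℕ} (hv : (toEnd ℂ L M y ^ n) v = 0) (m : M) :
    ∃ k, (toEnd ℂ L M y ^ k) m = 0 := by
  let S : LieSubmodule ℂ L M :=
    { (toEnd ℂ L M y).maxGenEigenspace 0 with
      lie_mem := by
        intro z m hm
        have hz : z ∈ (toEnd ℂ L L y).maxGenEigenspace 0 := by
          obtain ⟨k, hk⟩ := hy
          rw [Module.End.mem_maxGenEigenspace]
          exact ⟨k, by rw [zero_smul, sub_zero]; exact LinearMap.congr_fun hk z⟩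
        simpa using lie_mem_maxGenEigenspace_toEnd hz hm }
  have hS : S = ⊤ := by
    rw [eq_top_iff, ← hgen, LieSubmodule.lieSpan_le, Set.singleton_subset_iff]
    change v ∈ (toEnd ℂ L M y).maxGenEigenspace 0
    rw [Module.End.mem_maxGenEigenspace]
    exact ⟨n, by simpa using hv⟩
  have hm : m ∈ S := hS ▸ LieSubmodule.mem_top m
  change m ∈ (toEnd ℂ L M y).maxGenEigenspace 0 at hm
  rw [Module.End.mem_maxGenEigenspace] at hm
  simpa using hm

section Sl2

variable {L M : Type*} [LieRing L] [LieAlgebra ℂ L]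
  [AddCommGroup M] [Module ℂ M] [LieRingModule L M] [LieModule ℂ L M] {h e f : L}

/-- An `h`-eigenvector raised as far as possible by a locally nilpotent `e` is a primitive vector,
whose `f`-string is governed by a natural number if `f` is locally nilpotent too. -/
theorem IsSl2Triple.exists_pow_pow_ne_zero (t : IsSl2Triple h e f)
    (he : ∀ m : M, ∃ k, (toEnd ℂ L M e ^ k) m = 0) (hf : ∀ m : M, ∃ k, (toEnd ℂ L M f ^ k) m = 0)
    {m : M} (hm0 : m ≠ 0) {c : ℂ} (hm : ⁅h, m⁆ = c • m) :
    ∃ a d : ℕ, c = d - 2 * a ∧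
      ∀ i ≤ d, (toEnd ℂ L M f ^ i) ((toEnd ℂ L M e ^ a) m) ≠ 0 := by
  obtain ⟨a, ha, ha'⟩ := Nat.exists_not_and_succ_of_not_zero_of_exists
    (p := fun k => (toEnd ℂ L M e ^ k) m = 0) (by simpa using hm0) (he m)
  have P : t.HasPrimitiveVectorWith ((toEnd ℂ L M e ^ a) m) (c + 2 * a) :=
    ⟨ha, t.lie_h_pow_toEnd_e hm a, by
      rwa [pow_succ', Module.End.mul_apply, toEnd_apply_apply] at ha'⟩
  obtain ⟨d, hd, hd'⟩ := Nat.exists_not_and_succ_of_not_zero_of_exists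
    (p := fun k => (toEnd ℂ L M f ^ k) ((toEnd ℂ L M e ^ a) m) = 0) (by simpa using ha) (hf _)
  have hcd : c + 2 * a = d := by
    have := P.lie_e_pow_succ_toEnd_f d
    rw [hd', lie_zero, eq_comm, smul_eq_zero_iff_left hd, mul_eq_zero, sub_eq_zero] at this
    exact this.resolve_left (Nat.cast_add_one_ne_zero d)
  exact ⟨a, d, by rw [← hcd]; ring, fun i hi => P.pow_toEnd_f_ne_zero_of_eq_nat hcd hi⟩

/-- In an integrable representation of `𝔰𝔩₂`, from a vector of weight `c` one reaches a nonzero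
vector of weight `-c`. -/
theorem IsSl2Triple.exists_reflect (t : IsSl2Triple h e f)
    (he : ∀ m : M, ∃ k, (toEnd ℂ L M e ^ k) m = 0) (hf : ∀ m : M, ∃ k, (toEnd ℂ L M f ^ k) m = 0)
    {m : M} (hm0 : m ≠ 0) {c : ℂ} (hm : ⁅h, m⁆ = c • m) :
    ∃ a j : ℕ, (c = j - a ∧ (toEnd ℂ L M f ^ j) ((toEnd ℂ L M e ^ a) m) ≠ 0) ∨
      (c = a - j ∧ (toEnd ℂ L M e ^ j) ((toEnd ℂ L M f ^ a) m) ≠ 0) := by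
  obtain ⟨a, d, hc, hd⟩ := t.exists_pow_pow_ne_zero he hf hm0 hm
  obtain ⟨a', d', hc', hd'⟩ := t.symm.exists_pow_pow_ne_zero hf he hm0 (c := -c) (by simp [hm])
  have key : (d : ℤ) - 2 * a = 2 * a' - d' := by
    have : ((d : ℤ) - 2 * a : ℂ) = 2 * a' - (d' : ℤ) := by
      push_cast; rw [← hc]; linear_combination -hc'
    exact_mod_cast this
  -- The string through the highest weight vector reaches weight `-c` if `a ≤ d`, that is, if
  -- `c + a ≥ 0`; otherwise `c < 0`, and the string through the lowest weight vector does.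
  by_cases hda : a ≤ d
  · refine ⟨a, d - a, Or.inl ⟨?_, hd _ (Nat.sub_le _ _)⟩⟩
    rw [hc]; push_cast [hda]; ring
  · have h' : a' ≤ d' := by omega
    refine ⟨a', d' - a', Or.inr ⟨?_, hd' _ (Nat.sub_le _ _)⟩⟩
    push_cast [h']; linear_combination -hc'

end Sl2

/-! ### Root vectors -/

namespace RootVectors

variable {b : (rootSystem H).Base} (x : RootVectors b)

theorem _root_.PosRoot.isNonZero (α : PosRoot b) : α.1.1.IsNonZero :=
  (Finset.mem_filter.1 α.1.2).2

theorem isSl2Triple (α : PosRoot b) : IsSl2Triple (α.h : 𝔤) (x.pos α) (x.neg α) := by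
  have hα := α.isNonZero
  have h2 : α.1.1 α.h = 2 := root_apply_coroot hα
  refine ⟨?_, x.lie_pos_neg α, ?_, ?_⟩
  · intro h0
    have h0' : α.h = 0 := by exact_mod_cast h0
    rw [h0'] at h2
    simp at h2
  · have := lie_eq_smul_of_mem_rootSpace (x.pos_mem α) α.h
    rw [h2] at this
    rw [← Nat.cast_smul_eq_nsmul ℂ]
    exact_mod_cast this
  · have := lie_eq_smul_of_mem_rootSpace (x.neg_mem α) α.h
    rw [Pi.neg_apply, h2, neg_smul] at this
    rw [← Nat.cast_smul_eq_nsmul ℂ]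
    exact_mod_cast this

theorem span_union_eq_top :
    Submodule.span ℂ ((H : Set 𝔤) ∪ (Set.range x.pos ∪ Set.range x.neg)) = ⊤ := by
  set S := Submodule.span ℂ ((H : Set 𝔤) ∪ (Set.range x.pos ∪ Set.range x.neg))
  have one_dim : ∀ (β : Weight ℂ H 𝔤) (_ : β.IsNonZero) (z : 𝔤), z ∈ rootSpace H β → z ≠ 0 →
      z ∈ S → ∀ y ∈ rootSpace H β, y ∈ S := by
    intro β hβ z hz hz0 hzS y hy
    obtain ⟨c, hc⟩ := (finrank_eq_one_iff_of_nonzero' (⟨z, hz⟩ : rootSpace H β)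
      (by simpa using hz0)).1 (finrank_rootSpace_eq_one β hβ) ⟨y, hy⟩
    have : y = c • z := by simpa using (congrArg Subtype.val hc).symm
    exact this ▸ S.smul_mem c hzS
  rw [eq_top_iff]
  intro y _
  have hy : y ∈ ⨆ χ : Weight ℂ H 𝔤, genWeightSpace 𝔤 χ := by
    simp [iSup_genWeightSpace_eq_top' ℂ H 𝔤]
  induction hy using LieSubmodule.iSup_induction' with
  | zero => exact S.zero_mem
  | add m₁ m₂ _ _ h₁ h₂ => exact S.add_mem (h₁ trivial) (h₂ trivial)
  | mem χ m hm =>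
    by_cases hχ : χ.IsNonZero
    · let i : H.root := ⟨χ, by simpa using hχ⟩
      let := (rootSystem H).indexNeg
      rcases RootPairing.Base.IsPos.or_neg b i with hi | hi
      · exact one_dim χ hχ (x.pos ⟨i, hi⟩) (x.pos_mem ⟨i, hi⟩) (x.isSl2Triple ⟨i, hi⟩).e_ne_zero
          (Submodule.subset_span (Or.inr (Or.inl ⟨_, rfl⟩))) m hm
      · have hneg : (-((-i : H.root) : Weight ℂ H 𝔤) : H → ℂ) = (χ : H → ℂ) := by
          have := (rootSystem H).root_reflectionPerm i i
          have h3 : (rootSystem H).root (-i) = -(rootSystem H).root i := by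
            rw [RootPairing.indexNeg_neg, this, RootPairing.reflection_apply_self]
          funext h
          have := LinearMap.congr_fun h3 h
          simp only [rootSystem_root_apply, Weight.toLinear_apply, LinearMap.neg_apply] at this
          rw [Pi.neg_apply, this, neg_neg]
        refine one_dim χ hχ (x.neg ⟨-i, hi⟩) ?_ (x.isSl2Triple ⟨-i, hi⟩).f_ne_zero
          (Submodule.subset_span (Or.inr (Or.inr ⟨_, rfl⟩))) m hm
        have := x.neg_mem ⟨-i, hi⟩
        rwa [hneg] at this
    · have h0 : (χ : H → ℂ) = 0 := by simpa [Weight.IsNonZero] using hχ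
      have : m ∈ rootSpace H (0 : H → ℂ) := h0 ▸ hm
      rw [rootSpace_zero_eq] at this
      exact Submodule.subset_span (Or.inl (by simpa using this))

/-- Linear statements about `𝔤` may be checked on `𝔥` and on the root vectors. -/
@[elab_as_elim]
theorem induction {p : 𝔤 → Prop} (cartan : ∀ h : H, p h) (pos : ∀ α, p (x.pos α))
    (neg : ∀ α, p (x.neg α)) (add : ∀ y z, p y → p z → p (y + z))
    (smul : ∀ (c : ℂ) y, p y → p (c • y)) (y : 𝔤) : p y := by
  have hy : y ∈ Submodule.span ℂ ((H : Set 𝔤) ∪ (Set.range x.pos ∪ Set.range x.neg)) := by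
    rw [x.span_union_eq_top]; trivial
  induction hy using Submodule.span_induction with
  | zero => simpa using cartan 0
  | add y z _ _ hy hz => exact add y z hy hz
  | smul c y _ hy => exact smul c y hy
  | mem y hy =>
    rcases hy with hy | ⟨α, rfl⟩ | ⟨α, rfl⟩
    · exact cartan ⟨y, hy⟩
    · exact pos α
    · exact neg α

end RootVectors

/-- A dual height function: some `h₀ ∈ 𝔥` takes a positive integer value at each positive root. -/
theorem exists_forall_posRoot_apply_eq_natCast (b : (rootSystem H).Base) :
    ∃ h₀ : H, ∀ α : PosRoot b, ∃ n : ℕ, 0 < n ∧ α.1.1 h₀ = n := by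
  let F : Module.Dual ℂ (Module.Dual ℂ H) := b.toWeightBasis.constr ℂ fun _ => (1 : ℂ)
  have hF : ∀ j ∈ b.support, F ((rootSystem H).root j) = 1 := fun j hj => by
    have := b.toWeightBasis.constr_basis ℂ (fun _ => (1 : ℂ)) ⟨j, hj⟩
    rwa [RootPairing.Base.toWeightBasis_apply] at this
  obtain ⟨h₀, hh₀⟩ := (Module.evalEquiv ℂ H).surjective F
  refine ⟨h₀, fun α => ⟨(b.height α.1).toNat, ?_, ?_⟩⟩
  · have := α.2
    rw [RootPairing.Base.isPos_iff] at this
    omega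
  · obtain ⟨f, -, -, hf⟩ := b.exists_root_eq_sum_int α.1
    have h1 := b.height_eq_sum hf
    have h2 : F ((rootSystem H).root α.1) = (b.height α.1 : ℂ) := by
      rw [hf, h1, map_sum, Int.cast_sum]
      refine Finset.sum_congr rfl fun j hj => ?_
      rw [map_zsmul, hF j hj]; simp
    have h3 : ((b.height α.1).toNat : ℂ) = ((b.height α.1 : ℤ) : ℂ) := by
      have : ((b.height α.1).toNat : ℤ) = b.height α.1 := Int.toNat_of_nonneg (le_of_lt α.2)
      exact_mod_cast congrArg (Int.cast : ℤ → ℂ) this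
    rw [h3, ← h2, ← hh₀]
    simp [Module.evalEquiv]

end Integrability

/-! ### Weights of highest weight modules -/

section WeightSet

open LieModule

variable {M : Type*} [AddCommGroup M] [Module ℂ M] [LieRingModule 𝔤 M] [LieModule ℂ 𝔤 M]

variable (H M) in
/-- The weights of a `𝔤`-module of arbitrary dimension: the functionals `μ` on `𝔥` with a nonzero
(honest, not generalized) weight vector. -/
def weightSet : Set (Module.Dual ℂ H) :=
  {μ | ∃ m : M, m ≠ 0 ∧ ∀ h : H, ⁅(h : 𝔤), m⁆ = μ h • m}

theorem lie_lie_eq_smul_of_mem_rootSpace {χ : H → ℂ} {z : 𝔤} (hz : z ∈ rootSpace H χ) {c : ℂ}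
    {h : H} {m : M} (hm : ⁅(h : 𝔤), m⁆ = c • m) :
    ⁅(h : 𝔤), ⁅z, m⁆⁆ = (c + χ h) • ⁅z, m⁆ := by
  have hz' : ⁅(h : 𝔤), z⁆ = χ h • z := lie_eq_smul_of_mem_rootSpace hz h
  rw [leibniz_lie, hz', hm, lie_smul, smul_lie, ← add_smul, add_comm]

theorem lie_pow_toEnd_eq_smul_of_mem_rootSpace {χ : H → ℂ} {z : 𝔤} (hz : z ∈ rootSpace H χ) {c : ℂ}
    {h : H} {m : M} (hm : ⁅(h : 𝔤), m⁆ = c • m) (n : ℕ) :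
    ⁅(h : 𝔤), (toEnd ℂ 𝔤 M z ^ n) m⁆ = (c + n * χ h) • (toEnd ℂ 𝔤 M z ^ n) m := by
  induction n with
  | zero => simpa using hm
  | succ n ih =>
    rw [pow_succ', Module.End.mul_apply, toEnd_apply_apply, lie_lie_eq_smul_of_mem_rootSpace hz ih]
    congr 1
    push_cast
    ring

namespace RootVectors

variable {b : (rootSystem H).Base} (x : RootVectors b)

theorem isNilpotent_ad_pos (α : PosRoot b) : _root_.IsNilpotent (ad ℂ 𝔤 (x.pos α)) :=
  isNilpotent_ad_of_mem_rootSpace H α.isNonZero (x.pos_mem α)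

theorem isNilpotent_ad_neg (α : PosRoot b) : _root_.IsNilpotent (ad ℂ 𝔤 (x.neg α)) :=
  isNilpotent_ad_of_mem_rootSpace H (neg_ne_zero.2 α.isNonZero) (x.neg_mem α)

/-- Weights are permuted by the reflection in a root whose root vectors act locally nilpotently. -/
theorem reflection_mem_weightSet (α : PosRoot b)
    (hpos : ∀ m : M, ∃ k, (toEnd ℂ 𝔤 M (x.pos α) ^ k) m = 0)
    (hneg : ∀ m : M, ∃ k, (toEnd ℂ 𝔤 M (x.neg α) ^ k) m = 0)
    {μ : Module.Dual ℂ H} (hμ : μ ∈ weightSet H M) :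
    (rootSystem H).reflection α.1 μ ∈ weightSet H M := by
  obtain ⟨m, hm0, hm⟩ := hμ
  have hrefl : ∀ h : H, (rootSystem H).reflection α.1 μ h = μ h - μ α.h * α.1.1 h := fun h => by
    rw [RootPairing.reflection_apply]; rfl
  obtain ⟨a, j, ⟨hc, h0⟩ | ⟨hc, h0⟩⟩ :=
    (x.isSl2Triple α).exists_reflect hpos hneg hm0 (hm α.h)
  · refine ⟨_, h0, fun h => ?_⟩
    rw [lie_pow_toEnd_eq_smul_of_mem_rootSpace (x.neg_mem α)
      (lie_pow_toEnd_eq_smul_of_mem_rootSpace (x.pos_mem α) (hm h) a) j, hrefl, hc, Pi.neg_apply]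
    congr 1; ring
  · refine ⟨_, h0, fun h => ?_⟩
    rw [lie_pow_toEnd_eq_smul_of_mem_rootSpace (x.pos_mem α)
      (lie_pow_toEnd_eq_smul_of_mem_rootSpace (x.neg_mem α) (hm h) a) j, hrefl, hc, Pi.neg_apply]
    congr 1; ring

/-- The monomials in the negative root vectors, applied to `v`. -/
inductive IsLoweringMonomial (v : M) : M → Prop
  | gen : IsLoweringMonomial v v
  | lower (α : PosRoot b) (m : M) : IsLoweringMonomial v m → IsLoweringMonomial v ⁅x.neg α, m⁆

/-- A highest weight module is spanned by the lowering monomials. This is the part of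
`U(𝔤) = U(𝔫⁻) U(𝔥) U(𝔫⁺)` that is needed here, obtained without the PBW theorem. -/
theorem span_isLoweringMonomial_eq_top {v : M} {lam : Module.Dual ℂ H}
    (hgen : LieSubmodule.lieSpan ℂ 𝔤 {v} = ⊤) (hpos : ∀ α, ⁅x.pos α, v⁆ = 0)
    (hH : ∀ h : H, ⁅(h : 𝔤), v⁆ = lam h • v) :
    Submodule.span ℂ {m | x.IsLoweringMonomial v m} = ⊤ := by
  set S := Submodule.span ℂ {m | x.IsLoweringMonomial v m}
  have hneg : ∀ α, ∀ m ∈ S, ⁅x.neg α, m⁆ ∈ S := by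
    intro α m hm
    induction hm using Submodule.span_induction with
    | mem m hm => exact Submodule.subset_span (IsLoweringMonomial.lower α m hm)
    | zero => simp
    | add m n _ _ hm hn => rw [lie_add]; exact S.add_mem hm hn
    | smul c m _ hm => rw [lie_smul]; exact S.smul_mem c hm
  have hall : ∀ m, x.IsLoweringMonomial v m → ∀ y : 𝔤, ⁅y, m⁆ ∈ S := by
    intro m hm
    induction hm with
    | gen =>
      intro y
      have hv : v ∈ S := Submodule.subset_span .gen
      induction y using x.induction with
      | cartan h => rw [hH]; exact S.smul_mem _ hv
      | pos α => rw [hpos]; exact S.zero_mem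
      | neg α => exact hneg α v hv
      | add y z hy hz => rw [add_lie]; exact S.add_mem hy hz
      | smul c y hy => rw [smul_lie]; exact S.smul_mem c hy
    | lower α m _ ih =>
      intro y
      rw [leibniz_lie]
      exact S.add_mem (ih _) (hneg α _ (ih _))
  let T : LieSubmodule ℂ 𝔤 M :=
    { S with
      lie_mem := by
        intro y m hm
        change m ∈ S at hm
        change ⁅y, m⁆ ∈ S
        induction hm using Submodule.span_induction with
        | mem m hm => exact hall m hm y
        | zero => simp
        | add m n _ _ hm hn => rw [lie_add]; exact S.add_mem hm hn
        | smul c m _ hm => rw [lie_smul]; exact S.smul_mem c hm }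
  have hT : T = ⊤ := by
    rw [eq_top_iff, ← hgen, LieSubmodule.lieSpan_le, Set.singleton_subset_iff]
    exact Submodule.subset_span (s := {m | x.IsLoweringMonomial v m}) .gen
  exact congrArg LieSubmodule.toSubmodule hT

/-- If `h₀` takes natural number values at the positive roots, its eigenvalues on a module of
highest weight `λ` lie in `λ(h₀) - ℕ`. -/
theorem exists_eigenvalue_eq_sub {v : M} {lam : Module.Dual ℂ H}
    (hgen : LieSubmodule.lieSpan ℂ 𝔤 {v} = ⊤) (hpos : ∀ α, ⁅x.pos α, v⁆ = 0)
    (hH : ∀ h : H, ⁅(h : 𝔤), v⁆ = lam h • v) {h₀ : H}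
    (hh₀ : ∀ α : PosRoot b, ∃ n : ℕ, α.1.1 h₀ = n) {m : M} (hm0 : m ≠ 0) {c : ℂ}
    (hm : ⁅(h₀ : 𝔤), m⁆ = c • m) : ∃ n : ℕ, c = lam h₀ - n := by
  by_contra! hc
  let f := toEnd ℂ 𝔤 M (h₀ : 𝔤)
  have hmono : ∀ u, x.IsLoweringMonomial v u → ∃ n : ℕ, f u = (lam h₀ - n) • u := by
    intro u hu
    induction hu with
    | gen => exact ⟨0, by simpa [f] using hH h₀⟩
    | lower α u _ ih =>
      obtain ⟨n, hn⟩ := ih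
      obtain ⟨k, hk⟩ := hh₀ α
      refine ⟨n + k, ?_⟩
      change ⁅(h₀ : 𝔤), ⁅x.neg α, u⁆⁆ = _
      rw [lie_lie_eq_smul_of_mem_rootSpace (x.neg_mem α) hn, Pi.neg_apply, hk]
      congr 1; push_cast; ring
  have htop : ⨆ n : ℕ, f.eigenspace (lam h₀ - n) = ⊤ := by
    rw [eq_top_iff, ← x.span_isLoweringMonomial_eq_top hgen hpos hH, Submodule.span_le]
    intro u hu
    obtain ⟨n, hn⟩ := hmono u hu
    exact Submodule.mem_iSup_of_mem n (Module.End.mem_eigenspace_iff.2 hn)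
  have hle : ⨆ n : ℕ, f.eigenspace (lam h₀ - n) ≤ ⨆ μ, ⨆ (_ : μ ≠ c), f.eigenspace μ :=
    iSup_le fun n => le_iSup₂_of_le (lam h₀ - n) (hc n).symm le_rfl
  have hdisj := f.eigenspaces_iSupIndep c
  rw [htop, top_le_iff] at hle
  rw [hle, disjoint_top] at hdisj
  have : m ∈ f.eigenspace c := Module.End.mem_eigenspace_iff.2 hm
  rw [hdisj, Submodule.mem_bot] at this
  exact hm0 this

theorem pow_toEnd_neg_eq_zero_of_lieSpan_eq_top {v : M} {lam : Module.Dual ℂ H}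
    (hlam : IsDominantIntegral b lam)
    (hgen : LieSubmodule.lieSpan ℂ 𝔤 {v} = ⊤) (hpos : ∀ α, ⁅x.pos α, v⁆ = 0)
    (hH : ∀ h : H, ⁅(h : 𝔤), v⁆ = lam h • v)
    (hneg : ∀ i : b.support, ∃ k, (toEnd ℂ 𝔤 M (x.neg (simpleRoot i)) ^ k) v = 0)
    (α : PosRoot b) {k : ℕ} (hk : natPairing lam α < k) :
    (toEnd ℂ 𝔤 M (x.neg α) ^ k) v = 0 := by
  -- The weights of `M` are stable under the simple reflections, hence under the one in `α`.
  have hsimple : ∀ i ∈ b.support, ∀ μ ∈ weightSet H M,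
      (rootSystem H).reflection i μ ∈ weightSet H M := fun i hi μ hμ => by
    obtain ⟨k, hk⟩ := hneg ⟨i, hi⟩
    exact x.reflection_mem_weightSet (simpleRoot ⟨i, hi⟩)
      (exists_pow_toEnd_eq_zero (x.isNilpotent_ad_pos _) hgen (n := 1) (by simpa using hpos _))
      (exists_pow_toEnd_eq_zero (x.isNilpotent_ad_neg _) hgen hk) hμ
  have hW : ∀ μ ∈ weightSet H M, (rootSystem H).reflection α.1 μ ∈ weightSet H M := by
    refine α.2.induction_on_reflect
      (p := fun i => ∀ μ ∈ weightSet H M, (rootSystem H).reflection i μ ∈ weightSet H M) hsimple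
      fun i j hi hj μ hμ => ?_
    rw [RootPairing.reflection_reflectionPerm]
    exact hsimple j hj _ (hi _ (hsimple j hj _ hμ))
  by_contra hne
  obtain ⟨h₀, hh₀⟩ := exists_forall_posRoot_apply_eq_natCast b
  -- Otherwise `λ - kα` is a weight, hence so is its reflection `λ + (k - λ(h_α))α`, which is too
  -- high.
  have hμ : lam - (k : ℂ) • α.1.1.toLinear ∈ weightSet H M := by
    refine ⟨_, hne, fun h => ?_⟩
    rw [lie_pow_toEnd_eq_smul_of_mem_rootSpace (x.neg_mem α) (hH h) k, Pi.neg_apply]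
    congr 1
    simp [sub_eq_add_neg]
  obtain ⟨m, hm0, hm⟩ := hW _ hμ
  obtain ⟨n, hn⟩ := x.exists_eigenvalue_eq_sub hgen hpos hH
    (fun α => (hh₀ α).imp fun _ h => h.2) hm0 (hm h₀)
  obtain ⟨p, hp, hp'⟩ := hh₀ α
  have h2 : α.1.1 α.h = 2 := root_apply_coroot α.isNonZero
  have key : (rootSystem H).reflection α.1 (lam - (k : ℂ) • α.1.1.toLinear) h₀ =
      lam h₀ + (k - natPairing lam α) * p := by
    have : (rootSystem H).reflection α.1 (lam - (k : ℂ) • α.1.1.toLinear) h₀ =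
        (lam h₀ - k * α.1.1 h₀) - (lam α.h - k * α.1.1 α.h) * α.1.1 h₀ := by
      rw [RootPairing.reflection_apply]; rfl
    rw [this, h2, hp', ← cast_natPairing hlam α]
    ring
  rw [key] at hn
  have h3 : ((k : ℤ) - natPairing lam α) * p = -n := by
    have : ((k : ℂ) - natPairing lam α) * p = -n := by linear_combination hn
    exact_mod_cast this
  have h4 : 0 < ((k : ℤ) - natPairing lam α) * p :=
    mul_pos (by omega) (by exact_mod_cast hp)
  omega

/-- **Integrability.** A highest weight vector killed by powers of the simple negative root vectors
satisfies `(x_α^-) ^ (λ(h_α) + 1) v = 0` for every positive root `α`: the weights of `U(𝔤) v` are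
stable under the Weyl group and bounded above by `λ`. -/
theorem pow_toEnd_neg_eq_zero {v : M} {lam : Module.Dual ℂ H}
    (hlam : IsDominantIntegral b lam) (hpos : ∀ α, ⁅x.pos α, v⁆ = 0)
    (hH : ∀ h : H, ⁅(h : 𝔤), v⁆ = lam h • v)
    (hneg : ∀ i : b.support, ∃ k, (toEnd ℂ 𝔤 M (x.neg (simpleRoot i)) ^ k) v = 0)
    (α : PosRoot b) {k : ℕ} (hk : natPairing lam α < k) :
    (toEnd ℂ 𝔤 M (x.neg α) ^ k) v = 0 := by
  set N := LieSubmodule.lieSpan ℂ 𝔤 {v}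
  let v' : N := ⟨v, LieSubmodule.subset_lieSpan rfl⟩
  have hcoe : ∀ (y : 𝔤) (j : ℕ) (m : N),
      (((toEnd ℂ 𝔤 N y ^ j) m : N) : M) = (toEnd ℂ 𝔤 M y ^ j) m := by
    intro y j m
    induction j with
    | zero => rfl
    | succ j ih =>
      rw [pow_succ', pow_succ', Module.End.mul_apply, Module.End.mul_apply, ← ih]; rfl
  have hgen : LieSubmodule.lieSpan ℂ 𝔤 {v'} = ⊤ := by
    have hle : N ≤ (LieSubmodule.lieSpan ℂ 𝔤 {v'}).map N.incl := by
      rw [LieSubmodule.lieSpan_le, Set.singleton_subset_iff]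
      exact ⟨v', LieSubmodule.subset_lieSpan rfl, rfl⟩
    rw [eq_top_iff]
    rintro m -
    obtain ⟨m', hm', h⟩ := hle m.2
    rwa [← show m' = m from Subtype.ext h]
  have := x.pow_toEnd_neg_eq_zero_of_lieSpan_eq_top hlam hgen
    (fun α => Subtype.ext (hpos α)) (fun h => Subtype.ext (hH h))
    (fun i => (hneg i).imp fun k hk => Subtype.ext (by rw [hcoe]; exact hk)) α hk
  rw [← hcoe _ _ v', this]
  rfl

end RootVectors

end WeightSet

/-! ### Current algebras -/

section Current

open LieModule Polynomial

variable {𝔨 : Type*} [LieRing 𝔨] [LieAlgebra ℂ 𝔨]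

/-- The element `z ⊗ t ^ r` of `𝔤[t]`. -/
abbrev CurrentAlgebra.tPow (r : ℕ) (z : 𝔨) : CurrentAlgebra 𝔨 := (X ^ r : ℂ[X]) ⊗ₜ[ℂ] z

open CurrentAlgebra

theorem CurrentAlgebra.lie_tPow (r s : ℕ) (y z : 𝔨) :
    ⁅tPow r y, tPow s z⁆ = tPow (r + s) ⁅y, z⁆ := by
  simp only [tPow, ExtendScalars.bracket_tmul, pow_add]

theorem CurrentAlgebra.mul_X_pow_tmul_induction {p : CurrentAlgebra 𝔨 → Prop} {n : ℕ}
    (tPow : ∀ r z, n ≤ r → p (tPow r z)) (add : ∀ y z, p y → p z → p (y + z)) (q : ℂ[X]) (z : 𝔨) :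
    p ((X ^ n * q) ⊗ₜ[ℂ] z) := by
  induction q using Polynomial.induction_on' with
  | add q q' h h' => rw [mul_add, TensorProduct.add_tmul]; exact add _ _ h h'
  | monomial k a =>
    have := tPow (n + k) (a • z) (Nat.le_add_right n k)
    rwa [CurrentAlgebra.tPow, ← TensorProduct.smul_tmul, pow_add, ← mul_smul_comm,
      smul_X_eq_monomial] at this

@[elab_as_elim]
theorem CurrentAlgebra.induction {p : CurrentAlgebra 𝔨 → Prop}
    (tPow : ∀ r z, p (tPow r z)) (add : ∀ y z, p y → p z → p (y + z)) (y : CurrentAlgebra 𝔨) :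
    p y := by
  induction y using TensorProduct.induction_on with
  | zero => simpa using tPow 0 0
  | add y z hy hz => exact add y z hy hz
  | tmul q z =>
    have := mul_X_pow_tmul_induction (p := p) (n := 0) (fun r z _ => tPow r z) add q z
    rwa [pow_zero, one_mul] at this

variable {M : Type*} [AddCommGroup M] [LieRingModule (CurrentAlgebra 𝔨) M]

theorem CurrentAlgebra.tPow_lie_tPow_lie (r s : ℕ) (y z : 𝔨) (m : M) :
    ⁅tPow r y, ⁅tPow s z, m⁆⁆ = ⁅tPow (r + s) ⁅y, z⁆, m⁆ + ⁅tPow s z, ⁅tPow r y, m⁆⁆ := by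
  rw [leibniz_lie, lie_tPow]

/-! ### Garland's identity -/

/-- `IsGarlandSum f v r s m` says that `m` is a nonempty sum of vectors
`(f ⊗ t ^ p₁) ⋯ (f ⊗ t ^ p_r) v` with `p₁ + ⋯ + p_r = s`. -/
inductive IsGarlandSum (f : 𝔨) (v : M) : ℕ → ℕ → M → Prop
  | gen : IsGarlandSum f v 0 0 v
  | lower (p : ℕ) {r s : ℕ} {m : M} :
      IsGarlandSum f v r s m → IsGarlandSum f v (r + 1) (s + p) ⁅tPow p f, m⁆
  | add {r s : ℕ} {m m' : M} :
      IsGarlandSum f v r s m → IsGarlandSum f v r s m' → IsGarlandSum f v r s (m + m')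

namespace IsGarlandSum

variable {f : 𝔨} {v m : M} {r s : ℕ}

theorem lower' (p : ℕ) (hm : IsGarlandSum f v r s m) {r' s' : ℕ} (hr : r' = r + 1)
    (hs : s' = s + p) : IsGarlandSum f v r' s' ⁅tPow p f, m⁆ := by
  subst hr hs
  exact hm.lower p

theorem eq_zero {N : ℕ} (hf : ∀ p, N ≤ p → ∀ m : M, ⁅tPow p f, m⁆ = 0)
    (hm : IsGarlandSum f v r s m) (h : r * N < s + r) : m = 0 := by
  induction hm with
  | gen => simp at h
  | add _ _ ih ih' => rw [ih h, ih' h, add_zero]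
  | @lower p r s m _ ih =>
    rcases le_or_gt N p with hp | hp
    · exact hf p hp m
    · rw [ih (by rw [add_one_mul] at h; omega), lie_zero]

theorem exists_eq_nsmul (hm : IsGarlandSum f v 1 s m) :
    ∃ c : ℕ, 0 < c ∧ m = c • ⁅tPow s f, v⁆ := by
  have h0 : ∀ r s (m : M), IsGarlandSum f v r s m → r = 0 → s = 0 ∧ ∃ c : ℕ, 0 < c ∧ m = c • v := by
    intro r s m hm hr
    induction hm with
    | gen => exact ⟨rfl, 1, one_pos, (one_smul _ _).symm⟩
    | lower => omega
    | add _ _ ih ih' =>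
      obtain ⟨hs, c, hc, rfl⟩ := ih hr
      obtain ⟨-, c', -, rfl⟩ := ih' hr
      exact ⟨hs, c + c', by omega, (add_smul _ _ _).symm⟩
  generalize hr : 1 = r at hm
  induction hm with
  | gen => omega
  | lower p hm =>
    obtain ⟨rfl, c, hc, rfl⟩ := h0 _ _ _ hm (by omega)
    exact ⟨c, hc, by rw [lie_nsmul, zero_add]⟩
  | add _ _ ih ih' =>
    obtain ⟨c, hc, rfl⟩ := ih hr
    obtain ⟨c', -, rfl⟩ := ih' hr
    exact ⟨c + c', by omega, (add_smul _ _ _).symm⟩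

variable {h e : 𝔨} (t : IsSl2Triple h e f)
include t

theorem lie_h (hv : ∀ a, 0 < a → ⁅tPow a h, v⁆ = 0)
    (hm : IsGarlandSum f v r s m) {a : ℕ} (ha : 0 < a) :
    (r = 0 → ⁅tPow a h, m⁆ = 0) ∧
      (0 < r → ∃ m', IsGarlandSum f v r (s + a) m' ∧ ⁅tPow a h, m⁆ = -m') := by
  induction hm with
  | gen => exact ⟨fun _ => hv a ha, fun h => absurd h (lt_irrefl 0)⟩
  | @lower p r s m hm ih =>
    refine ⟨fun h => absurd h (Nat.succ_ne_zero r), fun _ => ?_⟩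
    have h1 : IsGarlandSum f v (r + 1) (s + p + a) ⁅tPow (a + p) f, m⁆ :=
      hm.lower' (a + p) rfl (by ring)
    have h2 : ⁅tPow a h, ⁅tPow p f, m⁆⁆ =
        -(⁅tPow (a + p) f, m⁆ + ⁅tPow (a + p) f, m⁆) + ⁅tPow p f, ⁅tPow a h, m⁆⁆ := by
      rw [tPow_lie_tPow_lie, t.lie_h_f_nsmul, two_nsmul, tPow, TensorProduct.tmul_neg,
        TensorProduct.tmul_add, neg_lie, add_lie]
    rcases Nat.eq_zero_or_pos r with hr | hr
    · exact ⟨_, h1.add h1, by rw [h2, ih.1 hr, lie_zero, add_zero]⟩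
    · obtain ⟨m', hm', he⟩ := ih.2 hr
      refine ⟨_, (h1.add h1).add (hm'.lower' p rfl (by ring)), ?_⟩
      rw [h2, he, lie_neg, neg_add _ ⁅tPow p f, m'⁆]
  | add hm hm' ih ih' =>
    refine ⟨fun h => by rw [lie_add, ih.1 h, ih'.1 h, add_zero], fun h => ?_⟩
    obtain ⟨n, hn, e1⟩ := ih.2 h
    obtain ⟨n', hn', e2⟩ := ih'.2 h
    exact ⟨_, hn.add hn', by rw [lie_add, e1, e2, neg_add]⟩

/-- All the terms created by commuting `e ⊗ t` past a monomial have the same sign. -/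
theorem lie_e (hv : ∀ a, 0 < a → ⁅tPow a h, v⁆ = 0) (hev : ⁅tPow 1 e, v⁆ = 0)
    (hm : IsGarlandSum f v r s m) :
    (r ≤ 1 → ⁅tPow 1 e, m⁆ = 0) ∧
      ∀ r', r = r' + 2 → ∃ m', IsGarlandSum f v (r' + 1) (s + 1) m' ∧ ⁅tPow 1 e, m⁆ = -m' := by
  induction hm with
  | gen => exact ⟨fun _ => hev, fun r' h => by omega⟩
  | @lower p r s m hm ih =>
    have h2 : ⁅tPow 1 e, ⁅tPow p f, m⁆⁆ = ⁅tPow (1 + p) h, m⁆ + ⁅tPow p f, ⁅tPow 1 e, m⁆⁆ := by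
      rw [tPow_lie_tPow_lie, t.lie_e_f]
    have hh := hm.lie_h t hv (a := 1 + p) (by omega)
    refine ⟨fun hr => ?_, fun r' hr => ?_⟩
    · rw [h2, hh.1 (by omega), ih.1 (by omega), lie_zero, add_zero]
    · obtain ⟨m₁, hm₁, e1⟩ := hh.2 (by omega)
      obtain rfl : r = r' + 1 := by omega
      have hs : s + (1 + p) = s + p + 1 := by ring
      rw [hs] at hm₁
      rcases Nat.eq_zero_or_pos r' with hr' | hr'
      · exact ⟨m₁, hm₁, by rw [h2, e1, ih.1 (by omega), lie_zero, add_zero]⟩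
      · obtain ⟨r'', rfl⟩ := Nat.exists_eq_succ_of_ne_zero hr'.ne'
        obtain ⟨m₂, hm₂, e2⟩ := ih.2 r'' rfl
        refine ⟨_, hm₁.add (hm₂.lower' p rfl (by ring)), ?_⟩
        rw [h2, e1, e2, lie_neg, neg_add]
  | add hm hm' ih ih' =>
    refine ⟨fun h => by rw [lie_add, ih.1 h, ih'.1 h, add_zero], fun r' h => ?_⟩
    obtain ⟨n, hn, e1⟩ := ih.2 r' h
    obtain ⟨n', hn', e2⟩ := ih'.2 r' h
    exact ⟨_, hn.add hn', by rw [lie_add, e1, e2, neg_add]⟩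

variable [Module ℂ M] [LieModule ℂ (CurrentAlgebra 𝔨) M]

/-- A weak form of Garland's identity: `(e ⊗ t) ^ s f ^ (s + r) v` is, up to sign, a nonempty sum of
monomials with `r` factors and total degree `s`. -/
theorem exists_pow_pow_eq (hv : ∀ a, 0 < a → ⁅tPow a h, v⁆ = 0) (hev : ⁅tPow 1 e, v⁆ = 0)
    (hr : 0 < r) (s : ℕ) : ∃ m, IsGarlandSum f v r s m ∧
      (toEnd ℂ (CurrentAlgebra 𝔨) M (tPow 1 e) ^ s)
        ((toEnd ℂ (CurrentAlgebra 𝔨) M (tPow 0 f) ^ (s + r)) v) = (-1 : ℂ) ^ s • m := by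
  have hf : ∀ n, IsGarlandSum f v n 0 ((toEnd ℂ (CurrentAlgebra 𝔨) M (tPow 0 f) ^ n) v) := by
    intro n
    induction n with
    | zero => exact .gen
    | succ n ih => rw [pow_succ', Module.End.mul_apply]; exact ih.lower 0
  have key : ∀ j r', 0 < r' → j + r' = s + r → ∃ m, IsGarlandSum f v r' j m ∧
      (toEnd ℂ (CurrentAlgebra 𝔨) M (tPow 1 e) ^ j)
        ((toEnd ℂ (CurrentAlgebra 𝔨) M (tPow 0 f) ^ (s + r)) v) = (-1 : ℂ) ^ j • m := by
    intro j
    induction j with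
    | zero =>
      intro r' _ h
      obtain rfl : r' = s + r := by omega
      exact ⟨_, hf _, by simp⟩
    | succ j ih =>
      intro r' hr' h
      obtain ⟨m, hm, e1⟩ := ih (r' + 1) (by omega) (by omega)
      obtain ⟨m', hm', e2⟩ := (hm.lie_e t hv hev).2 (r' - 1) (by omega)
      rw [Nat.sub_add_cancel hr'] at hm'
      refine ⟨m', hm', ?_⟩
      rw [pow_succ', Module.End.mul_apply, e1, map_smul, toEnd_apply_apply, e2, pow_succ,
        mul_neg_one, neg_smul, smul_neg]
  exact key s r hr rfl

end IsGarlandSum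

end Current

/-! ### The universal property of local Weyl modules -/

section UniversalProperty

open LieModule Polynomial CurrentAlgebra

attribute [local instance] LieRing.ofAssociativeRing

@[elab_as_elim]
theorem UniversalEnvelopingAlgebra.induction {R L : Type*} [CommRing R] [LieRing L] [LieAlgebra R L]
    {p : UniversalEnvelopingAlgebra R L → Prop} (algebraMap : ∀ c, p (algebraMap R _ c))
    (ι : ∀ y, p (ι R y)) (mul : ∀ u w, p u → p w → p (u * w))
    (add : ∀ u w, p u → p w → p (u + w)) (u : UniversalEnvelopingAlgebra R L) : p u := by
  obtain ⟨a, rfl⟩ : ∃ a, mkAlgHom R L a = u := Quotient.exists_rep u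
  induction a using TensorAlgebra.induction with
  | algebraMap c => rw [AlgHom.commutes]; exact algebraMap c
  | ι y => exact ι y
  | mul a c ha hc => rw [map_mul]; exact mul _ _ ha hc
  | add a c ha hc => rw [map_add]; exact add _ _ ha hc

variable {b : (rootSystem H).Base} (x : RootVectors b) (lam : Module.Dual ℂ H)

/-- The defining relations of the local Weyl module, for a vector `v` of a vector space on which
`𝔤[t]` acts through the linear map `ρ`. -/
structure IsWeylVector {P : Type*} [AddCommGroup P] [Module ℂ P]
    (ρ : CurrentAlgebra 𝔤 →ₗ[ℂ] Module.End ℂ P) (v : P) : Prop where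
  raising : ∀ r α, ρ (tPow r (x.pos α)) v = 0
  cartan : ∀ (h : H) r, ρ (tPow r (h : 𝔤)) v = (if r = 0 then lam h else 0) • v
  lowering : ∀ i : b.support,
    (ρ (tPow 0 (x.neg (simpleRoot i))) ^ (natPairing lam (simpleRoot i) + 1)) v = 0

namespace WeylModule

variable (A : Type) [CommRing A] [Algebra ℂ A] [Algebra ℂ[X] A]

theorem smul_gen (u : UniversalEnvelopingAlgebra ℂ (A ⊗[ℂ] 𝔤)) :
    u • gen x lam A = Submodule.Quotient.mk u := by
  have : u • gen x lam A = Submodule.Quotient.mk (u • 1) := rfl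
  rw [this, smul_eq_mul, mul_one]

variable {x lam A} in
theorem smul_gen_eq_zero {u : UniversalEnvelopingAlgebra ℂ (A ⊗[ℂ] 𝔤)}
    (hu : IsWeylRelation x lam A u) : u • gen x lam A = 0 := by
  rw [smul_gen]
  exact (Submodule.Quotient.mk_eq_zero _).2 (Submodule.subset_span hu)

variable [IsScalarTower ℂ ℂ[X] A]

section

variable {𝔨 : Type*} [LieRing 𝔨] [LieAlgebra ℂ 𝔨]

theorem currentMap_tmul (q : ℂ[X]) (z : 𝔨) :
    currentMap 𝔨 A (q ⊗ₜ[ℂ] z) = algebraMap ℂ[X] A q ⊗ₜ[ℂ] z := rfl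

theorem currentMap_surjective (hA : Function.Surjective (algebraMap ℂ[X] A)) :
    Function.Surjective (currentMap 𝔨 A) :=
  LinearMap.rTensor_surjective 𝔨 (g := (IsScalarTower.toAlgHom ℂ ℂ[X] A).toLinearMap) hA

variable {A} in
/-- An element of the kernel of `𝔤[t] → 𝔤 ⊗ A` acts by zero as soon as the `q ⊗ z` with `q` in the
kernel of `ℂ[t] → A` do. -/
theorem apply_eq_zero_of_currentMap_eq_zero (hA : Function.Surjective (algebraMap ℂ[X] A))
    {E : Type*} [AddCommGroup E] [Module ℂ E] {ρ : CurrentAlgebra 𝔨 →ₗ[ℂ] E}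
    (hker : ∀ q : ℂ[X], algebraMap ℂ[X] A q = 0 → ∀ z : 𝔨, ρ (q ⊗ₜ[ℂ] z) = 0)
    {y : CurrentAlgebra 𝔨} (hy : currentMap 𝔨 A y = 0) : ρ y = 0 := by
  let g : ℂ[X] →ₗ[ℂ] A := (IsScalarTower.toAlgHom ℂ ℂ[X] A).toLinearMap
  have hex : Function.Exact (LinearMap.ker g).subtype g := LinearMap.exact_subtype_ker_map g
  obtain ⟨w, rfl⟩ := ((rTensor_exact 𝔨 hex hA) y).1 hy
  induction w using TensorProduct.induction_on with
  | zero => simp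
  | tmul q z => exact hker q.1 q.2 z
  | add w w' hw hw' =>
    have h1 : ∀ w, currentMap 𝔨 A (((LinearMap.ker g).subtype.rTensor 𝔨) w) = 0 := fun w =>
      ((rTensor_exact 𝔨 hex hA) _).2 ⟨w, rfl⟩
    rw [map_add, map_add, hw (h1 w), hw' (h1 w'), add_zero]

end

theorem ι_pow_smul (y : CurrentAlgebra 𝔤) (n : ℕ) (m : WeylModule x lam A) :
    UniversalEnvelopingAlgebra.ι ℂ (currentMap 𝔤 A y) ^ n • m =
      (toEnd ℂ (CurrentAlgebra 𝔤) (WeylModule x lam A) y ^ n) m := by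
  induction n with
  | zero => rw [pow_zero, pow_zero, one_smul]; rfl
  | succ n ih => rw [pow_succ', pow_succ', mul_smul, ih]; rfl

theorem isWeylVector_gen :
    IsWeylVector x lam (toEnd ℂ (CurrentAlgebra 𝔤) (WeylModule x lam A) : _ →ₗ[ℂ] _)
      (gen x lam A) where
  raising r α := smul_gen_eq_zero (.raising (algebraMap ℂ[X] A (X ^ r)) α)
  cartan h r := by
    have := smul_gen_eq_zero (.cartan (x := x) (lam := lam) (A := A) h r)
    rw [sub_smul, sub_eq_zero, algebraMap_smul, ← map_pow] at this
    exact this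
  lowering i := by
    have := smul_gen_eq_zero (.lowering (x := x) (lam := lam) (A := A) i)
    rw [← map_one (algebraMap ℂ[X] A), ← currentMap_tmul, ι_pow_smul] at this
    exact this

theorem lieSpan_gen (hA : Function.Surjective (algebraMap ℂ[X] A)) :
    LieSubmodule.lieSpan ℂ (CurrentAlgebra 𝔤) {gen x lam A} = ⊤ := by
  set K := LieSubmodule.lieSpan ℂ (CurrentAlgebra 𝔤) {gen x lam A}
  have hu : ∀ u : UniversalEnvelopingAlgebra ℂ (A ⊗[ℂ] 𝔤), ∀ m ∈ K, u • m ∈ K := by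
    intro u
    induction u using UniversalEnvelopingAlgebra.induction with
    | algebraMap c => intro m hm; rw [algebraMap_smul]; exact K.smul_mem c hm
    | ι y =>
      intro m hm
      obtain ⟨y, rfl⟩ := currentMap_surjective A hA y
      exact K.lie_mem (x := y) hm
    | mul u w hu hw => intro m hm; rw [mul_smul]; exact hu _ (hw _ hm)
    | add u w hu hw => intro m hm; rw [add_smul]; exact K.add_mem (hu _ hm) (hw _ hm)
  rw [eq_top_iff]
  rintro m -
  obtain ⟨u, rfl⟩ := Submodule.Quotient.mk_surjective _ m
  have := hu u _ (LieSubmodule.subset_lieSpan (s := {gen x lam A}) rfl)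
  rwa [smul_gen] at this

variable {x lam A}

/-- The universal property of `WeylModule x lam A`, for a quotient `A` of `ℂ[t]`. -/
theorem exists_lift (hA : Function.Surjective (algebraMap ℂ[X] A))
    {P : Type*} [AddCommGroup P] [Module ℂ P] {ρ : CurrentAlgebra 𝔤 →ₗ[ℂ] Module.End ℂ P}
    (hρ : ∀ y z m, ρ ⁅y, z⁆ m = ρ y (ρ z m) - ρ z (ρ y m))
    (hker : ∀ q : ℂ[X], algebraMap ℂ[X] A q = 0 → ∀ z : 𝔤, ρ (q ⊗ₜ[ℂ] z) = 0)
    {v : P} (hv : IsWeylVector x lam ρ v) :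
    ∃ f : WeylModule x lam A →ₗ[ℂ] P, f (gen x lam A) = v ∧
      ∀ (y : CurrentAlgebra 𝔤) m, f ⁅y, m⁆ = ρ y (f m) := by
  -- `ρ` descends to `𝔤 ⊗ A`: evaluate it at preimages chosen by a set-theoretic section `σ`.
  obtain ⟨σ, hσ⟩ := (currentMap_surjective (𝔨 := 𝔤) A hA).hasRightInverse
  have key : ∀ y a, currentMap 𝔤 A y = a → ρ (σ a) = ρ y := fun y a h => by
    rw [← sub_eq_zero, ← map_sub]
    exact apply_eq_zero_of_currentMap_eq_zero hA hker (by rw [map_sub, hσ, h, sub_self])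
  let ψ : A ⊗[ℂ] 𝔤 →ₗ⁅ℂ⁆ Module.End ℂ P :=
    { toFun := fun a => ρ (σ a)
      map_add' := fun a c => by
        rw [key (σ a + σ c) (a + c) (by rw [map_add, hσ, hσ]), map_add]
      map_smul' := fun r a => by
        rw [key (r • σ a) (r • a) (by rw [map_smul, hσ]), map_smul]; rfl
      map_lie' := fun {a c} => by
        rw [key ⁅σ a, σ c⁆ ⁅a, c⁆ (by rw [LieHom.map_lie, hσ, hσ])]
        ext m
        rw [hρ]; rfl }
  have hψ : ∀ y, ψ (currentMap 𝔤 A y) = ρ y := fun y => key y _ rfl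
  let Φ := UniversalEnvelopingAlgebra.lift ℂ ψ
  have hΦ : ∀ y, Φ (UniversalEnvelopingAlgebra.ι ℂ (currentMap 𝔤 A y)) = ρ y := fun y => by
    rw [← hψ y]; exact UniversalEnvelopingAlgebra.lift_ι_apply ℂ ψ _
  let : Module (UniversalEnvelopingAlgebra ℂ (A ⊗[ℂ] 𝔤)) P := Module.compHom P Φ.toRingHom
  have hsmul : ∀ u (p : P), u • p = Φ u p := fun _ _ => rfl
  have hrel : Submodule.span (UniversalEnvelopingAlgebra ℂ (A ⊗[ℂ] 𝔤))
      {u | IsWeylRelation x lam A u} ≤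
        LinearMap.ker (LinearMap.toSpanSingleton (UniversalEnvelopingAlgebra ℂ (A ⊗[ℂ] 𝔤)) P v) := by
    rw [Submodule.span_le]
    rintro u hu
    change u • v = 0
    rw [hsmul]
    cases hu with
    | raising a α =>
      obtain ⟨q, rfl⟩ := hA a
      rw [← currentMap_tmul, hΦ]
      induction q using Polynomial.induction_on' with
      | add q q' h h' =>
        rw [TensorProduct.add_tmul, map_add, LinearMap.add_apply, h, h', add_zero]
      | monomial k a =>
        rw [← smul_X_eq_monomial, ← TensorProduct.smul_tmul', map_smul, LinearMap.smul_apply,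
          hv.raising, smul_zero]
    | cartan h r =>
      rw [← map_pow, ← currentMap_tmul, map_sub, hΦ, AlgHom.commutes, LinearMap.sub_apply,
        hv.cartan, sub_eq_zero]
      rfl
    | lowering i =>
      rw [← map_one (algebraMap ℂ[X] A), ← currentMap_tmul, map_pow, hΦ]
      exact hv.lowering i
  let F : WeylModule x lam A →ₗ[UniversalEnvelopingAlgebra ℂ (A ⊗[ℂ] 𝔤)] P :=
    Submodule.liftQ _ _ hrel
  have hF : ∀ u m, F (u • m) = Φ u (F m) := fun u m => F.map_smul u m
  refine ⟨{ toFun := F, map_add' := F.map_add, map_smul' := fun c m => ?_ }, ?_, fun y m => ?_⟩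
  · rw [← algebraMap_smul (UniversalEnvelopingAlgebra ℂ (A ⊗[ℂ] 𝔤)) c m, hF, AlgHom.commutes]
    rfl
  · exact one_smul (UniversalEnvelopingAlgebra ℂ (A ⊗[ℂ] 𝔤)) v
  · change F (UniversalEnvelopingAlgebra.ι ℂ (currentMap 𝔤 A y) • m) = _
    rw [hF, hΦ]
    rfl

end WeylModule

end UniversalProperty

/-! ### Gradings -/

section Grading

open LieModule Polynomial CurrentAlgebra

section Cyclic

variable {𝔨 M : Type*} [LieRing 𝔨] [LieAlgebra ℂ 𝔨] [AddCommGroup M] [Module ℂ M]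
  [LieRingModule (CurrentAlgebra 𝔨) M]

theorem mem_cyclicPiece_zero (v : M) : v ∈ cyclicPiece (𝔤 := 𝔨) v 0 :=
  Submodule.subset_span ⟨[], by simp, rfl⟩

theorem map_cyclicPiece {M' : Type*} [AddCommGroup M'] [Module ℂ M']
    [LieRingModule (CurrentAlgebra 𝔨) M']
    (f : M →ₗ[ℂ] M') (hf : ∀ (y : CurrentAlgebra 𝔨) m, f ⁅y, m⁆ = ⁅y, f m⁆) (v : M) (k : ℤ) :
    (cyclicPiece (𝔤 := 𝔨) v k).map f = cyclicPiece (𝔤 := 𝔨) (f v) k := by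
  have key : ∀ l : List (ℕ × 𝔨), f (l.foldr (fun p m' => ⁅tPow p.1 p.2, m'⁆) v) =
      l.foldr (fun p m' => ⁅tPow p.1 p.2, m'⁆) (f v) := by
    intro l
    induction l with
    | nil => rfl
    | cons p l ih => rw [List.foldr_cons, hf, ih, List.foldr_cons]
  rw [cyclicPiece, Submodule.map_span, cyclicPiece]
  congr 1
  ext m
  constructor
  · rintro ⟨_, ⟨l, hl, rfl⟩, rfl⟩
    exact ⟨l, hl, key l⟩
  · rintro ⟨l, hl, rfl⟩
    exact ⟨_, ⟨l, hl, rfl⟩, key l⟩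

variable [LieModule ℂ (CurrentAlgebra 𝔨) M]

theorem lie_tPow_mem_cyclicPiece {v : M} (r : ℕ) (z : 𝔨) {k : ℤ} {m : M}
    (hm : m ∈ cyclicPiece (𝔤 := 𝔨) v k) :
    ⁅tPow r z, m⁆ ∈ cyclicPiece (𝔤 := 𝔨) v (k + r) := by
  induction hm using Submodule.span_induction with
  | mem m hm =>
    obtain ⟨l, hl, rfl⟩ := hm
    exact Submodule.subset_span ⟨(r, z) :: l, by rw [← hl]; simp [add_comm], rfl⟩
  | zero => simp
  | add m n _ _ hm hn => rw [lie_add]; exact Submodule.add_mem _ hm hn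
  | smul c m _ hm => rw [lie_smul]; exact Submodule.smul_mem _ c hm

theorem iSup_cyclicPiece {v : M} (hgen : LieSubmodule.lieSpan ℂ (CurrentAlgebra 𝔨) {v} = ⊤) :
    ⨆ k, cyclicPiece (𝔤 := 𝔨) v k = ⊤ := by
  set S := ⨆ k, cyclicPiece (𝔤 := 𝔨) v k
  have hS : ∀ (y : CurrentAlgebra 𝔨), ∀ m ∈ S, ⁅y, m⁆ ∈ S := by
    intro y m hm
    induction y using CurrentAlgebra.induction with
    | add y z hy hz => rw [add_lie]; exact S.add_mem hy hz
    | tPow r z =>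
      induction hm using Submodule.iSup_induction' with
      | mem k m hm => exact Submodule.mem_iSup_of_mem _ (lie_tPow_mem_cyclicPiece r z hm)
      | zero => simp
      | add m n _ _ hm hn => rw [lie_add]; exact S.add_mem hm hn
  let T : LieSubmodule ℂ (CurrentAlgebra 𝔨) M := { S with lie_mem := fun {y m} hm => hS y m hm }
  have hT : T = ⊤ := by
    rw [eq_top_iff, ← hgen, LieSubmodule.lieSpan_le, Set.singleton_subset_iff]
    exact Submodule.mem_iSup_of_mem (p := cyclicPiece (𝔤 := 𝔨) v) 0 (mem_cyclicPiece_zero v)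
  exact congrArg LieSubmodule.toSubmodule hT

/-- A cyclic module is graded by its cyclic pieces once the substitution `t ↦ 2t` is implemented by
an operator `D`: the piece of degree `k` then lies in the `2 ^ k`-eigenspace of `D`. -/
theorem isModuleGrading_cyclicPiece {v : M}
    (hgen : LieSubmodule.lieSpan ℂ (CurrentAlgebra 𝔨) {v} = ⊤) (D : Module.End ℂ M)
    (hv : D v = v) (hD : ∀ r (z : 𝔨) m, D ⁅tPow r z, m⁆ = (2 : ℂ) ^ r • ⁅tPow r z, D m⁆) :
    IsModuleGrading 𝔨 (cyclicPiece (𝔤 := 𝔨) v) := by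
  refine ⟨DirectSum.isInternal_submodule_of_iSupIndep_of_iSup_eq_top ?_ (iSup_cyclicPiece hgen),
    fun r z k m hm => lie_tPow_mem_cyclicPiece r z hm⟩
  have hinj : Function.Injective fun k : ℤ => (2 : ℂ) ^ k := by
    intro j k hjk
    have h : (2 : ℝ) ^ j = 2 ^ k := by simpa [norm_zpow] using congrArg norm hjk
    exact zpow_right_injective₀ (by norm_num) (by norm_num) h
  refine (D.eigenspaces_iSupIndep.comp hinj).mono fun k => ?_
  refine Submodule.span_le.2 ?_
  rintro m ⟨l, hl, rfl⟩
  subst hl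
  refine Module.End.mem_eigenspace_iff.2 ?_
  dsimp only
  induction l with
  | nil => simpa using hv
  | cons p l ih =>
    rw [List.foldr_cons, hD, ih, lie_smul, smul_smul, List.map_cons, List.sum_cons, Nat.cast_add,
      zpow_add₀ (two_ne_zero' ℂ), zpow_natCast, zpow_natCast]

end Cyclic

/-- The substitution `t ↦ 2t` on `ℂ[t]`. -/
def doubleX : ℂ[X] →ₐ[ℂ] ℂ[X] := aeval (C 2 * X)

theorem doubleX_X_pow (r : ℕ) : doubleX (X ^ r) = (2 : ℂ) ^ r • (X ^ r : ℂ[X]) := by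
  rw [doubleX, map_pow, aeval_X, mul_pow, ← C_pow, smul_eq_C_mul]

theorem mem_truncIdeal_natCast {n : ℕ} {q : ℂ[X]} : q ∈ truncIdeal n ↔ X ^ n ∣ q :=
  Ideal.mem_span_singleton

theorem mem_truncIdeal_top {q : ℂ[X]} : q ∈ truncIdeal ⊤ ↔ q = 0 :=
  Ideal.mem_bot

theorem doubleX_mem_truncIdeal {N : ℕ∞} {q : ℂ[X]} (hq : q ∈ truncIdeal N) :
    doubleX q ∈ truncIdeal N := by
  induction N using ENat.recTopCoe with
  | top => rw [mem_truncIdeal_top] at hq ⊢; rw [hq, map_zero]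
  | coe n =>
    rw [mem_truncIdeal_natCast] at hq ⊢
    refine dvd_trans ?_ (map_dvd doubleX hq)
    rw [doubleX_X_pow, smul_eq_C_mul]
    exact dvd_mul_left _ _

theorem algebraMap_truncatedPoly_surjective (N : ℕ∞) :
    Function.Surjective (algebraMap ℂ[X] (TruncatedPoly N)) :=
  Ideal.Quotient.mk_surjective

theorem algebraMap_truncatedPoly_eq_zero {N : ℕ∞} {q : ℂ[X]} :
    algebraMap ℂ[X] (TruncatedPoly N) q = 0 ↔ q ∈ truncIdeal N :=
  Ideal.Quotient.eq_zero_iff_mem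

theorem TruncatedWeylModule.tmul_lie {b : (rootSystem H).Base} {x : RootVectors b}
    {lam : Module.Dual ℂ H} {N : ℕ∞} {q : ℂ[X]} (hq : q ∈ truncIdeal N) (z : 𝔤)
    (m : TruncatedWeylModule x lam N) : ⁅(q ⊗ₜ[ℂ] z : CurrentAlgebra 𝔤), m⁆ = 0 := by
  rw [WeylModule.lie_def, WeylModule.currentMap_tmul, algebraMap_truncatedPoly_eq_zero.2 hq,
    TensorProduct.zero_tmul, map_zero, zero_smul]

/-- The relations of `W_N(λ)` are homogeneous, so `t ↦ 2t` acts on it. -/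
theorem TruncatedWeylModule.exists_scaling {b : (rootSystem H).Base} (x : RootVectors b)
    (lam : Module.Dual ℂ H) (N : ℕ∞) :
    ∃ D : Module.End ℂ (TruncatedWeylModule x lam N),
      D (WeylModule.gen x lam (TruncatedPoly N)) = WeylModule.gen x lam (TruncatedPoly N) ∧
      ∀ r (z : 𝔤) m, D ⁅tPow r z, m⁆ = (2 : ℂ) ^ r • ⁅tPow r z, D m⁆ := by
  let τ : CurrentAlgebra 𝔤 →ₗ⁅ℂ⁆ CurrentAlgebra 𝔤 := ExtendScalars.map doubleX LieHom.id
  have hτ : ∀ r (z : 𝔤), τ (tPow r z) = (2 : ℂ) ^ r • tPow r z := fun r z => by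
    change doubleX (X ^ r) ⊗ₜ[ℂ] z = _
    rw [doubleX_X_pow, TensorProduct.smul_tmul']
  let ρ : CurrentAlgebra 𝔤 →ₗ[ℂ] Module.End ℂ (TruncatedWeylModule x lam N) :=
    (toEnd ℂ (CurrentAlgebra 𝔤) (TruncatedWeylModule x lam N) : _ →ₗ[ℂ] _) ∘ₗ
      (τ : CurrentAlgebra 𝔤 →ₗ[ℂ] CurrentAlgebra 𝔤)
  have hρ : ∀ y m, ρ y m = ⁅τ y, m⁆ := fun _ _ => rfl
  have hρt : ∀ r (z : 𝔤), ρ (tPow r z) =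
      (2 : ℂ) ^ r • toEnd ℂ (CurrentAlgebra 𝔤) (TruncatedWeylModule x lam N) (tPow r z) :=
    fun r z => by
      ext m
      exact (congrArg (⁅·, m⁆) (hτ r z)).trans (smul_lie ((2 : ℂ) ^ r) (tPow r z) m)
  have hgen := WeylModule.isWeylVector_gen x lam (TruncatedPoly N)
  obtain ⟨D, hD, hD'⟩ := WeylModule.exists_lift (x := x) (lam := lam)
    (algebraMap_truncatedPoly_surjective N) (ρ := ρ)
    (fun y z m => by rw [hρ, hρ, hρ, hρ, hρ, LieHom.map_lie, lie_lie])
    (fun q hq z => by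
      ext m
      exact TruncatedWeylModule.tmul_lie
        (doubleX_mem_truncIdeal (algebraMap_truncatedPoly_eq_zero.1 hq)) z m)
    (v := WeylModule.gen x lam (TruncatedPoly N))
    { raising := fun r α => by
        rw [hρt, LinearMap.smul_apply]
        exact smul_eq_zero_of_right _ (hgen.raising r α)
      cartan := fun h r => by
        rw [hρt, LinearMap.smul_apply]
        refine (congrArg _ (hgen.cartan h r)).trans ?_
        split_ifs with hr
        · rw [hr, pow_zero, one_smul]
        · rw [zero_smul, smul_zero]
      lowering := fun i => by
        rw [hρt, pow_zero, one_smul]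
        exact hgen.lowering i }
  exact ⟨D, hD, fun r z m => by
    rw [hD', hρt]
    rfl⟩

end Grading

/-! ### The partitions `ξ_N^λ` -/

section Partitions

theorem le_mul_add_partitionTail {n r : ℕ} (p : n.Partition) (hr : ∀ a ∈ p.parts, a ≤ r) (k : ℕ) :
    n ≤ r * k + partitionTail p k := by
  set l := p.parts.sort (· ≥ ·) with hl
  have hsum : l.sum = n := by
    rw [← p.parts_sum, ← Multiset.sum_coe, hl, Multiset.sort_eq]
  have h1 : (l.take k).sum ≤ (l.take k).length • r :=
    List.sum_le_card_nsmul _ _ fun a ha => hr a ((Multiset.mem_sort _).1 (List.mem_of_mem_take ha))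
  have h2 : (l.take k).length * r ≤ k * r := Nat.mul_le_mul_right _ (List.length_take_le _ _)
  have h3 := List.sum_take_add_sum_drop l k
  rw [smul_eq_mul] at h1
  change n ≤ r * k + (l.drop k).sum
  rw [mul_comm r k]
  omega

theorem mul_card_le_mul_add_partitionTail {n r : ℕ} (p : n.Partition) (hr : ∀ a ∈ p.parts, r ≤ a)
    (k : ℕ) : r * p.parts.card ≤ r * k + partitionTail p k := by
  set l := p.parts.sort (· ≥ ·) with hl
  have hlen : l.length = p.parts.card := Multiset.length_sort _
  have h1 : (l.drop k).length • r ≤ (l.drop k).sum :=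
    List.card_nsmul_le_sum _ _ fun a ha => hr a ((Multiset.mem_sort _).1 (List.mem_of_mem_drop ha))
  rw [smul_eq_mul, List.length_drop, hlen] at h1
  change _ ≤ r * k + (l.drop k).sum
  calc r * p.parts.card ≤ r * (k + (p.parts.card - k)) := Nat.mul_le_mul_left _ (by omega)
    _ = r * k + (p.parts.card - k) * r := by ring
    _ ≤ _ := by omega

theorem partitionTail_eq_zero {n k : ℕ} (p : n.Partition) (hk : p.parts.card ≤ k) :
    partitionTail p k = 0 := by
  rw [partitionTail, List.drop_of_length_le (by rwa [Multiset.length_sort]), List.sum_nil]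

theorem card_truncParts (n : ℕ) {N : ℕ} (hN : 0 < N) : (truncParts n N).card = N := by
  have := (Nat.mod_lt n hN).le
  change (Multiset.replicate (n % N) (n / N + 1) + Multiset.replicate (N - n % N) (n / N)).card = N
  rw [Multiset.card_add, Multiset.card_replicate, Multiset.card_replicate]
  omega

theorem mem_truncParts {n N a : ℕ} (ha : a ∈ truncParts n N) : n / N ≤ a ∧ a ≤ n / N + 1 := by
  change a ∈ Multiset.replicate (n % N) (n / N + 1) + Multiset.replicate (N - n % N) (n / N) at ha
  rcases Multiset.mem_add.1 ha with h | h <;> rw [Multiset.eq_of_mem_replicate h] <;> omega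

theorem mem_truncParts_top {n a : ℕ} (ha : a ∈ truncParts n ⊤) : a = 1 :=
  Multiset.eq_of_mem_replicate ha

variable {b : (rootSystem H).Base} {lam : Module.Dual ℂ H}

theorem mem_truncParts_of_mem_truncFamily {N : ℕ∞} {hN : N ≠ 0} {α : PosRoot b} {a : ℕ}
    (ha : a ∈ (truncFamily b lam N hN α).parts) : a ∈ truncParts (natPairing lam α) N :=
  Multiset.mem_of_mem_filter ha

theorem card_truncFamily_le {N : ℕ} (hN : (N : ℕ∞) ≠ 0) (α : PosRoot b) :
    (truncFamily b lam N hN α).parts.card ≤ N :=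
  (Multiset.card_le_card (Multiset.filter_le _ _)).trans_eq
    (card_truncParts _ (Nat.pos_of_ne_zero (by exact_mod_cast hN)))

theorem card_truncFamily {N : ℕ} (hN : (N : ℕ∞) ≠ 0) (α : PosRoot b)
    (hα : 0 < natPairing lam α / N) : (truncFamily b lam N hN α).parts.card = N := by
  have hN0 : 0 < N := Nat.pos_of_ne_zero (by exact_mod_cast hN)
  refine (congrArg Multiset.card (Multiset.filter_eq_self.2 fun a ha => ?_)).trans
    (card_truncParts (natPairing lam α) hN0)
  have := (mem_truncParts ha).1
  omega

end Partitions

/-! ### Comparison of the two modules -/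

section Comparison

open LieModule Polynomial CurrentAlgebra

variable {b : (rootSystem H).Base} {x : RootVectors b} {lam : Module.Dual ℂ H}

theorem LinearMap.map_toEnd_pow {L M M' : Type*} [LieRing L] [LieAlgebra ℂ L]
    [AddCommGroup M] [Module ℂ M] [LieRingModule L M] [LieModule ℂ L M]
    [AddCommGroup M'] [Module ℂ M'] [LieRingModule L M'] [LieModule ℂ L M'] (f : M →ₗ[ℂ] M')
    (hf : ∀ (y : L) m, f ⁅y, m⁆ = ⁅y, f m⁆) (y : L) (n : ℕ) (m : M) :
    f ((toEnd ℂ L M y ^ n) m) = (toEnd ℂ L M' y ^ n) (f m) := by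
  induction n with
  | zero => rfl
  | succ n ih =>
    rw [pow_succ', pow_succ', Module.End.mul_apply, Module.End.mul_apply, ← ih]
    exact hf y _

/-- Linear `L`-equivariant maps that agree on a generator agree everywhere. -/
theorem LinearMap.eq_of_lieSpan_eq_top {L M M' : Type*} [LieRing L] [LieAlgebra ℂ L]
    [AddCommGroup M] [Module ℂ M] [LieRingModule L M] [LieModule ℂ L M]
    [AddCommGroup M'] [Module ℂ M'] [LieRingModule L M']
    {f g : M →ₗ[ℂ] M'} (hf : ∀ (y : L) m, f ⁅y, m⁆ = ⁅y, f m⁆)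
    (hg : ∀ (y : L) m, g ⁅y, m⁆ = ⁅y, g m⁆) {v : M}
    (hgen : LieSubmodule.lieSpan ℂ L {v} = ⊤) (hv : f v = g v) (m : M) : f m = g m := by
  have hm : m ∈ LieSubmodule.lieSpan ℂ L {v} := hgen ▸ LieSubmodule.mem_top m
  induction hm using LieSubmodule.lieSpan_induction with
  | mem m hm => rwa [Set.mem_singleton_iff.1 hm]
  | zero => rw [map_zero, map_zero]
  | add m n _ _ hm hn => rw [map_add, map_add, hm, hn]
  | smul c m _ hm => rw [map_smul, map_smul, hm]
  | lie y m _ hm => rw [hf, hg, hm]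

/-- If the ideal `𝔤 ⊗ (t ^ N)` kills a generator, it kills the module. -/
theorem X_pow_mul_tmul_lie_eq_zero {𝔨 M : Type*} [LieRing 𝔨] [LieAlgebra ℂ 𝔨] [AddCommGroup M]
    [Module ℂ M] [LieRingModule (CurrentAlgebra 𝔨) M] [LieModule ℂ (CurrentAlgebra 𝔨) M] {v : M}
    (hgen : LieSubmodule.lieSpan ℂ (CurrentAlgebra 𝔨) {v} = ⊤) {N : ℕ}
    (hv : ∀ s, N ≤ s → ∀ z : 𝔨, ⁅tPow s z, v⁆ = 0) (q : ℂ[X]) (z : 𝔨) (m : M) :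
    ⁅((X ^ N * q) ⊗ₜ[ℂ] z : CurrentAlgebra 𝔨), m⁆ = 0 := by
  have hall : ∀ s, N ≤ s → ∀ z : 𝔨, ⁅tPow s z, m⁆ = 0 := by
    have hm : m ∈ LieSubmodule.lieSpan ℂ (CurrentAlgebra 𝔨) {v} := hgen ▸ LieSubmodule.mem_top m
    induction hm using LieSubmodule.lieSpan_induction with
    | mem m hm => rw [Set.mem_singleton_iff.1 hm]; exact hv
    | zero => intro s hs z; rw [lie_zero]
    | add m n _ _ hm hn => intro s hs z; rw [lie_add, hm s hs, hn s hs, add_zero]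
    | smul c m _ hm => intro s hs z; rw [lie_smul, hm s hs, smul_zero]
    | lie y m _ hm =>
      intro s hs z
      induction y using CurrentAlgebra.induction with
      | tPow r y => rw [tPow_lie_tPow_lie, hm (s + r) (by omega), hm s hs, lie_zero, add_zero]
      | add y y' hy hy' => rw [add_lie, lie_add, hy, hy', add_zero]
  exact CurrentAlgebra.mul_X_pow_tmul_induction (p := fun y => ⁅y, m⁆ = 0)
    (fun r z hr => hall r hr z) (fun y y' hy hy' => by rw [add_lie, hy, hy', add_zero]) q z

section WeylVector

variable {M : Type*} [AddCommGroup M] [Module ℂ M] [LieRingModule (CurrentAlgebra 𝔤) M]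
  [LieModule ℂ (CurrentAlgebra 𝔤) M] {v : M}

theorem IsWeylVector.map {M' : Type*} [AddCommGroup M'] [Module ℂ M']
    [LieRingModule (CurrentAlgebra 𝔤) M'] [LieModule ℂ (CurrentAlgebra 𝔤) M']
    (hv : IsWeylVector x lam (toEnd ℂ (CurrentAlgebra 𝔤) M : _ →ₗ[ℂ] _) v) (f : M →ₗ[ℂ] M')
    (hf : ∀ (y : CurrentAlgebra 𝔤) m, f ⁅y, m⁆ = ⁅y, f m⁆) :
    IsWeylVector x lam (toEnd ℂ (CurrentAlgebra 𝔤) M' : _ →ₗ[ℂ] _) (f v) where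
  raising r α := (hf _ _).symm.trans ((congrArg f (hv.raising r α)).trans (map_zero f))
  cartan h r := (hf _ _).symm.trans ((congrArg f (hv.cartan h r)).trans (map_smul f _ _))
  lowering i := (f.map_toEnd_pow hf _ _ _).symm.trans
    ((congrArg f (hv.lowering i)).trans (map_zero f))

theorem IsWeylVector.exists_isGarlandSum
    (hv : IsWeylVector x lam (toEnd ℂ (CurrentAlgebra 𝔤) M : _ →ₗ[ℂ] _) v) (α : PosRoot b)
    {r : ℕ} (hr : 0 < r) (s : ℕ) : ∃ m, IsGarlandSum (x.neg α) v r s m ∧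
      (toEnd ℂ (CurrentAlgebra 𝔤) M (tPow 1 (x.pos α)) ^ s)
        ((toEnd ℂ (CurrentAlgebra 𝔤) M (tPow 0 (x.neg α)) ^ (s + r)) v) = (-1 : ℂ) ^ s • m :=
  IsGarlandSum.exists_pow_pow_eq (x.isSl2Triple α)
    (fun a ha => (hv.cartan α.h a).trans (by rw [if_neg ha.ne', zero_smul])) (hv.raising 1 α) hr s

/-- The embedding `𝔤 → 𝔤[t]` onto the constant currents. -/
def CurrentAlgebra.const (𝔨 : Type*) [LieRing 𝔨] [LieAlgebra ℂ 𝔨] :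
    𝔨 →ₗ⁅ℂ⁆ CurrentAlgebra 𝔨 where
  toFun := tPow 0
  map_add' := TensorProduct.tmul_add _
  map_smul' c z := TensorProduct.tmul_smul c _ z
  map_lie' := (lie_tPow 0 0 _ _).symm

theorem IsWeylVector.pow_neg_eq_zero (hlam : IsDominantIntegral b lam)
    (hv : IsWeylVector x lam (toEnd ℂ (CurrentAlgebra 𝔤) M : _ →ₗ[ℂ] _) v) (α : PosRoot b)
    {k : ℕ} (hk : natPairing lam α < k) :
    (toEnd ℂ (CurrentAlgebra 𝔤) M (tPow 0 (x.neg α)) ^ k) v = 0 := by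
  let : LieRingModule 𝔤 M := LieRingModule.compLieHom M (CurrentAlgebra.const 𝔤)
  have : LieModule ℂ 𝔤 M := LieModule.compLieHom M (CurrentAlgebra.const 𝔤)
  exact x.pow_toEnd_neg_eq_zero hlam (fun α => hv.raising 0 α)
    (fun h => (hv.cartan h 0).trans (by rw [if_pos rfl])) (fun i => ⟨_, hv.lowering i⟩) α hk

end WeylVector

theorem cvRelation_eq (α : PosRoot b) (s r : ℕ) :
    (UniversalEnvelopingAlgebra.ι ℂ ((X : ℂ[X]) ⊗ₜ[ℂ] x.pos α) ^ s *
      UniversalEnvelopingAlgebra.ι ℂ ((1 : ℂ[X]) ⊗ₜ[ℂ] x.neg α) ^ (s + r)) •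
        WeylModule.gen x lam ℂ[X] =
    (toEnd ℂ (CurrentAlgebra 𝔤) (WeylModule x lam ℂ[X]) (tPow 1 (x.pos α)) ^ s)
      ((toEnd ℂ (CurrentAlgebra 𝔤) (WeylModule x lam ℂ[X]) (tPow 0 (x.neg α)) ^ (s + r))
        (WeylModule.gen x lam ℂ[X])) := by
  have h1 : (X : ℂ[X]) ⊗ₜ[ℂ] x.pos α = WeylModule.currentMap 𝔤 ℂ[X] (tPow 1 (x.pos α)) := by
    rw [WeylModule.currentMap_tmul, pow_one]; rfl
  have h2 : (1 : ℂ[X]) ⊗ₜ[ℂ] x.neg α = WeylModule.currentMap 𝔤 ℂ[X] (tPow 0 (x.neg α)) := by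
    rw [WeylModule.currentMap_tmul, pow_zero, map_one]
  rw [h1, h2, mul_smul, WeylModule.ι_pow_smul, WeylModule.ι_pow_smul]

/-- The defining relations of `CV(ξ_N^λ)` hold in `W_N(λ)`. For `r > q_α` they follow from
`(x_α^-) ^ (λ(h_α) + 1) w = 0`; for `r ≤ q_α` they force `s > r (N - 1)`, so that every monomial
`(x_α^- ⊗ t ^ p₁) ⋯ (x_α^- ⊗ t ^ p_r)` with `p₁ + ⋯ + p_r = s` has a factor with `p_i ≥ N`. -/
theorem TruncatedWeylModule.pow_pow_eq_zero (hlam : IsDominantIntegral b lam) {N : ℕ∞}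
    (hN : N ≠ 0) (α : PosRoot b) {s r k : ℕ} (hr : 0 < r)
    (h : s + r > r * k + partitionTail (truncFamily b lam N hN α) k) :
    (toEnd ℂ (CurrentAlgebra 𝔤) (TruncatedWeylModule x lam N) (tPow 1 (x.pos α)) ^ s)
      ((toEnd ℂ (CurrentAlgebra 𝔤) (TruncatedWeylModule x lam N) (tPow 0 (x.neg α)) ^ (s + r))
        (WeylModule.gen x lam (TruncatedPoly N))) = 0 := by
  have hgen := WeylModule.isWeylVector_gen x lam (TruncatedPoly N)
  have of_le : (∀ a ∈ (truncFamily b lam N hN α).parts, a ≤ r) →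
      (toEnd ℂ (CurrentAlgebra 𝔤) (TruncatedWeylModule x lam N) (tPow 1 (x.pos α)) ^ s)
      ((toEnd ℂ (CurrentAlgebra 𝔤) (TruncatedWeylModule x lam N) (tPow 0 (x.neg α)) ^ (s + r))
        (WeylModule.gen x lam (TruncatedPoly N))) = 0 := fun ha => by
    rw [hgen.pow_neg_eq_zero hlam α ((le_mul_add_partitionTail _ ha k).trans_lt h), map_zero]
  induction N using ENat.recTopCoe with
  | top =>
    refine of_le fun a ha => ?_
    rw [mem_truncParts_top (mem_truncParts_of_mem_truncFamily ha)]
    exact hr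
  | coe N =>
    rcases lt_or_ge (natPairing lam α / N) r with hq | hq
    · exact of_le fun a ha =>
        (mem_truncParts (mem_truncParts_of_mem_truncFamily ha)).2.trans hq
    · have hle := mul_card_le_mul_add_partitionTail (truncFamily b lam N hN α) (fun a ha =>
        hq.trans (mem_truncParts (mem_truncParts_of_mem_truncFamily ha)).1) k
      rw [card_truncFamily hN α (hr.trans_le hq)] at hle
      obtain ⟨m, hm, e⟩ := hgen.exists_isGarlandSum α hr s
      have h0 : m = 0 := hm.eq_zero (N := N)
        (fun p hp m => TruncatedWeylModule.tmul_lie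
          (mem_truncIdeal_natCast.2 (pow_dvd_pow X hp)) _ m) (hle.trans_lt h)
      exact e.trans (by rw [h0, smul_zero])

theorem CVModule.lieSpan_gen (xi : CompatibleFamily b lam) :
    LieSubmodule.lieSpan ℂ (CurrentAlgebra 𝔤) {CVModule.gen x lam xi} = ⊤ := by
  rw [eq_top_iff, ← LieSubmodule.Quotient.range_mk', ← LieModuleHom.map_top,
    ← WeylModule.lieSpan_gen x lam ℂ[X] Function.surjective_id, LieSubmodule.map_le_iff_le_comap,
    LieSubmodule.lieSpan_le, Set.singleton_subset_iff]
  exact LieSubmodule.subset_lieSpan (s := {CVModule.gen x lam xi}) rfl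

theorem CVModule.isWeylVector_gen (xi : CompatibleFamily b lam) :
    IsWeylVector x lam (toEnd ℂ (CurrentAlgebra 𝔤) (CVModule x lam xi) : _ →ₗ[ℂ] _)
      (CVModule.gen x lam xi) :=
  (WeylModule.isWeylVector_gen x lam ℂ[X]).map (M' := CVModule x lam xi)
    (LieSubmodule.Quotient.mk' (cvSubmodule x lam xi) :
      WeylModule x lam ℂ[X] →ₗ[ℂ] CVModule x lam xi) fun _ _ => rfl

/-- If `ξ(α)` has at most `N` parts, the relation with `r = 1` and `k = N` in `CV(ξ)` amounts to
`(x_α^- ⊗ t ^ s) v = 0` for `s ≥ N`. -/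
theorem CVModule.lie_tPow_neg_gen (xi : CompatibleFamily b lam) (α : PosRoot b) {N s : ℕ}
    (hN : 0 < N) (hxi : (xi α).parts.card ≤ N) (hs : N ≤ s) :
    ⁅tPow s (x.neg α), CVModule.gen x lam xi⁆ = 0 := by
  let π : WeylModule x lam ℂ[X] →ₗ[ℂ] CVModule x lam xi :=
    (LieSubmodule.Quotient.mk' (cvSubmodule x lam xi) : _ →ₗ[ℂ] _)
  have hrel : (toEnd ℂ (CurrentAlgebra 𝔤) (CVModule x lam xi) (tPow 1 (x.pos α)) ^ s)
      ((toEnd ℂ (CurrentAlgebra 𝔤) (CVModule x lam xi) (tPow 0 (x.neg α)) ^ (s + 1))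
        (CVModule.gen x lam xi)) = 0 := by
    have h1 := cvRelation_eq (x := x) (lam := lam) α s 1
    have h2 : (UniversalEnvelopingAlgebra.ι ℂ ((X : ℂ[X]) ⊗ₜ[ℂ] x.pos α) ^ s *
      UniversalEnvelopingAlgebra.ι ℂ ((1 : ℂ[X]) ⊗ₜ[ℂ] x.neg α) ^ (s + 1)) •
        WeylModule.gen x lam ℂ[X] ∈ cvSubmodule x lam xi :=
      LieSubmodule.subset_lieSpan ⟨α, s, 1, by omega, one_pos,
        ⟨N, hN, by rw [partitionTail_eq_zero _ hxi]; omega⟩, rfl⟩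
    rw [h1] at h2
    have h3 : π _ = 0 := (LieSubmodule.Quotient.mk_eq_zero _).2 h2
    rw [π.map_toEnd_pow fun _ _ => rfl, π.map_toEnd_pow fun _ _ => rfl] at h3
    exact h3
  obtain ⟨m, hm, e⟩ := (CVModule.isWeylVector_gen (x := x) xi).exists_isGarlandSum α one_pos s
  obtain ⟨c, hc, rfl⟩ := hm.exists_eq_nsmul
  rw [hrel, eq_comm, smul_eq_zero_iff_right (pow_ne_zero s (by norm_num)),
    ← Nat.cast_smul_eq_nsmul ℂ, smul_eq_zero_iff_right (by exact_mod_cast hc.ne')] at e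
  exact e

/-- In `CV(ξ_N^λ)`, the ideal `𝔤 ⊗ (t ^ N)` acts by zero. -/
theorem CVModule.tmul_lie {N : ℕ∞} (hN : N ≠ 0) {q : ℂ[X]} (hq : q ∈ truncIdeal N) (z : 𝔤)
    (m : CVModule x lam (truncFamily b lam N hN)) :
    ⁅(q ⊗ₜ[ℂ] z : CurrentAlgebra 𝔤), m⁆ = 0 := by
  induction N using ENat.recTopCoe with
  | top => rw [mem_truncIdeal_top.1 hq, TensorProduct.zero_tmul, zero_lie]
  | coe N =>
    have hN0 : 0 < N := Nat.pos_of_ne_zero (by exact_mod_cast hN)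
    have hgen := CVModule.isWeylVector_gen (x := x) (truncFamily b lam N hN)
    have h0 : ∀ s, N ≤ s → ∀ z : 𝔤,
        ⁅tPow s z, CVModule.gen x lam (truncFamily b lam N hN)⁆ = 0 := by
      intro s hs z
      induction z using x.induction with
      | cartan h => exact (hgen.cartan h s).trans (by rw [if_neg (by omega), zero_smul])
      | pos α => exact hgen.raising s α
      | neg α => exact CVModule.lie_tPow_neg_gen _ α hN0 (card_truncFamily_le hN α) hs
      | add y z hy hz => rw [tPow, TensorProduct.tmul_add, add_lie, hy, hz, add_zero]
      | smul c z hz =>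
        rw [tPow, TensorProduct.tmul_smul]
        exact (smul_lie c (tPow s z) _).trans (by rw [hz, smul_zero])
    obtain ⟨q, rfl⟩ := mem_truncIdeal_natCast.1 hq
    exact X_pow_mul_tmul_lie_eq_zero (CVModule.lieSpan_gen _) h0 q z m

/-- The isomorphism of `𝔤[t]`-modules, matching the generators. -/
theorem exists_cvModule_equiv (x : RootVectors b) (hlam : IsDominantIntegral b lam) {N : ℕ∞}
    (hN : N ≠ 0) :
    ∃ e : CVModule x lam (truncFamily b lam N hN) ≃ₗ⁅ℂ, CurrentAlgebra 𝔤⁆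
        TruncatedWeylModule x lam N,
      e (CVModule.gen x lam (truncFamily b lam N hN)) = WeylModule.gen x lam (TruncatedPoly N) := by
  set xi := truncFamily b lam N hN
  obtain ⟨f, hf, hf'⟩ := WeylModule.exists_lift (x := x) (lam := lam) (A := ℂ[X])
    Function.surjective_id (P := TruncatedWeylModule x lam N)
    (ρ := (toEnd ℂ (CurrentAlgebra 𝔤) (TruncatedWeylModule x lam N) : _ →ₗ[ℂ] _))
    (fun y z m => lie_lie (M := TruncatedWeylModule x lam N) y z m)
    (fun q hq z => by
      have hq : q = 0 := hq
      rw [hq, TensorProduct.zero_tmul, map_zero])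
    (WeylModule.isWeylVector_gen x lam (TruncatedPoly N))
  replace hf' : ∀ (y : CurrentAlgebra 𝔤) m, f ⁅y, m⁆ = ⁅y, f m⁆ := hf'
  obtain ⟨g, hg, hg'⟩ := WeylModule.exists_lift (x := x) (lam := lam) (A := TruncatedPoly N)
    (algebraMap_truncatedPoly_surjective N) (P := CVModule x lam xi)
    (ρ := (toEnd ℂ (CurrentAlgebra 𝔤) (CVModule x lam xi) : _ →ₗ[ℂ] _))
    (fun y z m => lie_lie y z m)
    (fun q hq z => by
      ext m
      exact CVModule.tmul_lie hN (algebraMap_truncatedPoly_eq_zero.1 hq) z m)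
    (CVModule.isWeylVector_gen xi)
  replace hg' : ∀ (y : CurrentAlgebra 𝔤) m, g ⁅y, m⁆ = ⁅y, g m⁆ := hg'
  let fHom : WeylModule x lam ℂ[X] →ₗ⁅ℂ, CurrentAlgebra 𝔤⁆ TruncatedWeylModule x lam N :=
    { f with map_lie' := fun {y m} => hf' y m }
  have hker : cvSubmodule x lam xi ≤ fHom.ker := by
    refine LieSubmodule.lieSpan_le.2 ?_
    rintro _ ⟨α, s, r, -, hr, ⟨k, -, hk⟩, rfl⟩
    change f _ = 0
    rw [cvRelation_eq, f.map_toEnd_pow hf', f.map_toEnd_pow hf', hf]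
    exact TruncatedWeylModule.pow_pow_eq_zero hlam hN α hr hk
  let F : CVModule x lam xi →ₗ[ℂ] TruncatedWeylModule x lam N :=
    (cvSubmodule x lam xi).toSubmodule.liftQ f fun m hm => hker hm
  have hF : ∀ (y : CurrentAlgebra 𝔤) m, F ⁅y, m⁆ = ⁅y, F m⁆ := by
    intro y m
    obtain ⟨m, rfl⟩ := LieSubmodule.Quotient.surjective_mk' _ m
    exact hf' y m
  have hFgen : F (CVModule.gen x lam xi) = WeylModule.gen x lam (TruncatedPoly N) := hf
  refine ⟨{ F with
    map_lie' := fun {y m} => hF y m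
    invFun := g
    left_inv := fun m => ?_
    right_inv := fun m => ?_ }, hFgen⟩
  · exact LinearMap.eq_of_lieSpan_eq_top (L := CurrentAlgebra 𝔤) (f := g ∘ₗ F) (g := LinearMap.id)
      (fun y m => by simp only [LinearMap.comp_apply, hF, hg']) (fun _ _ => rfl)
      (CVModule.lieSpan_gen xi) ((congrArg g hFgen).trans hg) m
  · exact LinearMap.eq_of_lieSpan_eq_top (L := CurrentAlgebra 𝔤) (f := F ∘ₗ g) (g := LinearMap.id)
      (fun y m => by simp only [LinearMap.comp_apply, hF, hg']) (fun _ _ => rfl)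
      (WeylModule.lieSpan_gen x lam _ (algebraMap_truncatedPoly_surjective N))
      ((congrArg F hg).trans hFgen) m

end Comparison

end

theorem theorem2p3 {𝔤 : Type*} [LieRing 𝔤] [LieAlgebra ℂ 𝔤] [FiniteDimensional ℂ 𝔤]
    [LieAlgebra.IsSimple ℂ 𝔤] (H : LieSubalgebra ℂ 𝔤) [H.IsCartanSubalgebra]
    (b : (rootSystem H).Base) (x : RootVectors b)
    (lam : Module.Dual ℂ H) (hlam : IsDominantIntegral b lam) (N : ℕ∞) (hN : N ≠ 0) :
    IsModuleGrading 𝔤 (cyclicPiece (𝔤 := 𝔤) (WeylModule.gen x lam (TruncatedPoly N))) ∧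
    IsModuleGrading 𝔤 (cyclicPiece (𝔤 := 𝔤) (CVModule.gen x lam (truncFamily b lam N hN))) ∧
    ∃ e : CVModule x lam (truncFamily b lam N hN) ≃ₗ⁅ℂ, CurrentAlgebra 𝔤⁆
        TruncatedWeylModule x lam N,
      ∀ k : ℤ,
        (cyclicPiece (𝔤 := 𝔤) (CVModule.gen x lam (truncFamily b lam N hN)) k).map
            (e : CVModule x lam (truncFamily b lam N hN) →ₗ[ℂ] TruncatedWeylModule x lam N) =
          cyclicPiece (𝔤 := 𝔤) (WeylModule.gen x lam (TruncatedPoly N)) k := by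
  obtain ⟨D, hD, hD'⟩ := TruncatedWeylModule.exists_scaling x lam N
  obtain ⟨e, he⟩ := exists_cvModule_equiv x hlam hN
  refine ⟨isModuleGrading_cyclicPiece
    (WeylModule.lieSpan_gen x lam _ (algebraMap_truncatedPoly_surjective N)) D hD hD', ?_, e,
    fun k => ?_⟩
  · -- The operator of the first grading is transported along `e`.
    let E : CVModule x lam (truncFamily b lam N hN) →ₗ[ℂ] TruncatedWeylModule x lam N := e
    let E' : TruncatedWeylModule x lam N →ₗ[ℂ] CVModule x lam (truncFamily b lam N hN) := e.symm
    have hE : ∀ m, E' (E m) = m := e.left_inv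
    refine isModuleGrading_cyclicPiece (CVModule.lieSpan_gen _) (E' ∘ₗ D ∘ₗ E) ?_ fun r z m => ?_
    · change E' (D (e _)) = _
      rw [he, hD, ← he]
      exact hE _
    · have h1 : E ⁅CurrentAlgebra.tPow r z, m⁆ = ⁅CurrentAlgebra.tPow r z, E m⁆ :=
        e.toLieModuleHom.map_lie _ _
      have h2 : ∀ n, E' ⁅CurrentAlgebra.tPow r z, n⁆ = ⁅CurrentAlgebra.tPow r z, E' n⁆ :=
        fun n => e.symm.toLieModuleHom.map_lie _ _
      rw [LinearMap.comp_apply, LinearMap.comp_apply, h1, hD', map_smul, h2]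
      rfl
  · refine (map_cyclicPiece (e.toLieModuleHom :
        CVModule x lam (truncFamily b lam N hN) →ₗ[ℂ] TruncatedWeylModule x lam N)
      (fun y m => e.toLieModuleHom.map_lie y m) _ k).trans ?_
    exact congrArg (cyclicPiece (𝔤 := 𝔤) · k) he
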